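/- Let $\mathbb H^2$ be the hyperbolic plane with metric $\mathbf h$, and let $\mathcal N$ be either the round unit sphere $\mathbb S^2$ or $\mathbb H^2$, with metric $(\cdot,\cdot)$ and curvature tensor $R$. Fix an origin in the domain and one in the target, and let $\Omega$, $\tilde\Omega$ be the generators of the rotations about these origins. Call a smooth map $Q:\mathbb H^2\to\mathcal N$ *equivariant* if $\mathrm dQ(\Omega)=\tilde\Omega(Q)$, of *finite energy* if $\int_{\mathbb H^2}(\partial^\ell Q,\partial_\ell Q)<\infty$, and *harmonic* if $D^\ell\partial_\ell Q=0$, where $D$ is the pull-back covariant derivative on $Q^*T\mathcal N$. For a section $\phi$ of $Q^*T\mathcal N$ put $$\mathcal H_Q\phi=-D^\ell D_\ell\phi-R(Q)(\phi,\partial_\ell Q)\,\partial^\ell Q .$$ Call $Q$ *weakly linearly stable* if there is $\rho_Q>0$ such that, for every smooth compactly supported section $\phi$ of $Q^*T\mathcal N$, $$\int_{\mathbb H^2}(\mathcal H_Q\phi,\phi)\ \ge\ \rho_Q^2\int_{\mathbb H^2}(\phi,\phi).$$ **Proposition.** Every smooth finite-energy equivariant harmonic map $Q:\mathbb H^2\to\mathcal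 N$, with $\mathcal N=\mathbb S^2$ or $\mathbb H^2$, is weakly linearly stable. In particular, the following maps, written in geodesic polar coordinates about the origins of the domain and the target, are weakly linearly stable: - $Q_\lambda(r,\theta)=(2\arctan(\lambda\tanh(r/2)),\theta)$, $\mathbb H^2\to\mathbb S^2$, for every $0\le\lambda<\infty$; - $P_\lambda(r,\theta)=(2\,\mathrm{arctanh}(\lambda\tanh(r/2)),\theta)$, $\mathbb H^2\to\mathbb H^2$, for every $0\le\lambda<1$. -/

import Mathlib

open scoped ContDiff
open MeasureTheory

noncomputable section

namespace HypHarmonic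

/-! ### The domain: the hyperbolic plane in the Poincare disk model -/

/-- The coordinate plane of the Poincare disk. -/
abbrev Plane : Type := EuclideanSpace ℝ (Fin 2)

/-- The open unit disk, carrying the global coordinates `(x⁰, x¹)` of the hyperbolic plane. -/
def disk : Set Plane := Metric.ball 0 1

/-- The hyperbolic metric `h = 4 |dz|² / (1 - |z|²)²`, as the matrix of its components `h_{jk}`. -/
def metric (z : Plane) : Matrix (Fin 2) (Fin 2) ℝ :=
  (4 / (1 - ‖z‖ ^ 2) ^ 2) • (1 : Matrix (Fin 2) (Fin 2) ℝ)

/-- The density `√(det h)` of the Riemannian volume with respect to Lebesgue measure. -/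
def volDensity (z : Plane) : ℝ := Real.sqrt (metric z).det

/-- The integral over the hyperbolic plane with respect to the Riemannian volume. -/
def hypIntegral (f : Plane → ℝ) : ℝ := ∫ z in disk, f z * volDensity z

/-- The coordinate derivative `∂_j f`. -/
def pd {F : Type*} [NormedAddCommGroup F] [NormedSpace ℝ F] (j : Fin 2) (f : Plane → F)
    (z : Plane) : F :=
  fderiv ℝ f z (EuclideanSpace.single j 1)

/-- The Christoffel symbols
`Γ^l_{jk} = (1/2) h^{lm} (∂_j h_{km} + ∂_k h_{mj} - ∂_m h_{jk})` of the domain. -/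
def christoffel (l j k : Fin 2) (z : Plane) : ℝ :=
  (1 / 2) * ∑ m, (metric z)⁻¹ l m *
    (pd j (fun w => metric w k m) z + pd k (fun w => metric w m j) z
      - pd m (fun w => metric w j k) z)

/-- The generator `Ω = ∂_θ` of the rotations of the disk about the origin. -/
def rot (z : Plane) : Plane := !₂[-z 1, z 0]

/-- The geodesic distance `r` from the origin of the disk, `r = 2 arctanh |z|`. -/
def radius (z : Plane) : ℝ := 2 * Real.artanh ‖z‖

/-! ### The targets: the round sphere and the hyperbolic plane -/

/-- The two target surfaces. -/
inductive Target : Type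
  | sphere
  | hyperbolic

namespace Target

/-- The Gauss curvature: `+1` for the sphere and `-1` for the hyperbolic plane. -/
def curv : Target → ℝ
  | sphere => 1
  | hyperbolic => -1

/-- The bilinear form of the ambient space `ℝ³`: the Euclidean inner product for the sphere, the
Minkowski form of signature `(+, +, -)` for the hyperbolic plane. -/
def form (N : Target) (v w : Fin 3 → ℝ) : ℝ :=
  v 0 * w 0 + v 1 * w 1 + N.curv * (v 2 * w 2)

/-- The unit sphere, respectively the upper sheet of the unit hyperboloid. The tangent plane at `y`
is the orthogonal complement of `y` for `N.form`, and the Riemannian metric is the restriction of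
`N.form` to the tangent planes. -/
def carrier : Target → Set (Fin 3 → ℝ)
  | sphere => {y | sphere.form y y = 1}
  | hyperbolic => {y | hyperbolic.form y y = -1 ∧ 0 < y 2}

/-- The orthogonal projection onto the tangent plane at `y` (where `N.form y y = N.curv = ±1`). -/
def proj (N : Target) (y v : Fin 3 → ℝ) : Fin 3 → ℝ :=
  v - (N.curv * N.form v y) • y

/-- The Riemann curvature tensor `R(X, Y) Z = κ ((Y, Z) X - (X, Z) Y)` of the surface, with the
convention `[D_j, D_k] φ = R(∂_j u, ∂_k u) φ` for sections `φ` along a map `u`. -/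
def riem (N : Target) (X Y Z : Fin 3 → ℝ) : Fin 3 → ℝ :=
  N.curv • (N.form Y Z • X - N.form X Z • Y)

/-- The generator of the rotations of the target about its origin `(0, 0, 1)`. -/
def rot (y : Fin 3 → ℝ) : Fin 3 → ℝ := ![-y 1, y 0, 0]

end Target

/-! ### Maps and sections along them

A map into the surface is a function `Q : Plane → Fin 3 → ℝ`, of which only the restriction to
`disk` matters; a section of the pull-back of the tangent bundle is a function
`φ : Plane → Fin 3 → ℝ` with `φ z` tangent at `Q z`. -/

/-- The pull-back covariant derivative `D_j φ`: the tangential part of `∂_j φ`. -/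
def covDeriv (N : Target) (Q : Plane → Fin 3 → ℝ) (j : Fin 2) (φ : Plane → Fin 3 → ℝ)
    (z : Plane) : Fin 3 → ℝ :=
  N.proj (Q z) (pd j φ z)

/-- The divergence `D^l Ψ_l = h^{jk} (D_j Ψ_k - Γ^l_{jk} Ψ_l)` of a one-form `Ψ` on the hyperbolic
plane with values in the pull-back of the tangent bundle. -/
def covDiv (N : Target) (Q : Plane → Fin 3 → ℝ) (Ψ : Fin 2 → Plane → Fin 3 → ℝ)
    (z : Plane) : Fin 3 → ℝ :=
  ∑ j, ∑ k, (metric z)⁻¹ j k • (covDeriv N Q j (Ψ k) z - ∑ l, christoffel l j k z • Ψ l z)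

/-- The energy density `(∂^l Q, ∂_l Q)`. -/
def energyDensity (N : Target) (Q : Plane → Fin 3 → ℝ) (z : Plane) : ℝ :=
  ∑ j, ∑ k, (metric z)⁻¹ j k * N.form (pd j Q z) (pd k Q z)

/-- A smooth map from the hyperbolic plane into the surface `N`. -/
def IsSmoothMap (N : Target) (Q : Plane → Fin 3 → ℝ) : Prop :=
  ContDiffOn ℝ ∞ Q disk ∧ ∀ z ∈ disk, Q z ∈ N.carrier

/-- Finite energy: `∂Q` is square integrable. -/
def HasFiniteEnergy (N : Target) (Q : Plane → Fin 3 → ℝ) : Prop :=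
  IntegrableOn (fun z => energyDensity N Q z * volDensity z) disk

/-- Equivariance: `dQ(Ω)` is the generator of rotations of the target at `Q`. -/
def IsEquivariant (Q : Plane → Fin 3 → ℝ) : Prop :=
  ∀ z ∈ disk, fderiv ℝ Q z (rot z) = Target.rot (Q z)

/-- The harmonic map equation `D^l ∂_l Q = 0`. -/
def IsHarmonic (N : Target) (Q : Plane → Fin 3 → ℝ) : Prop :=
  ∀ z ∈ disk, covDiv N Q (fun k => pd k Q) z = 0

/-- A smooth section of the pull-back of the tangent bundle along `Q`, compactly supported in the
hyperbolic plane (and extended by zero outside the disk). -/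
structure IsTestSection (N : Target) (Q φ : Plane → Fin 3 → ℝ) : Prop where
  smooth : ContDiff ℝ ∞ φ
  compactSupport : HasCompactSupport φ
  support_subset : tsupport φ ⊆ disk
  tangent : ∀ z ∈ disk, N.form (φ z) (Q z) = 0

/-- The linearized operator `𝓗_Q φ = - D^l D_l φ - R(Q)(φ, ∂_l Q) ∂^l Q`. -/
def linOp (N : Target) (Q φ : Plane → Fin 3 → ℝ) (z : Plane) : Fin 3 → ℝ :=
  - covDiv N Q (fun k => covDeriv N Q k φ) z
    - ∑ j, ∑ k, (metric z)⁻¹ j k • N.riem (φ z) (pd j Q z) (pd k Q z)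

/-- The weak linearized stability condition: there is `ρ > 0` such that
`∫ (𝓗_Q φ, φ) ≥ ρ² ∫ (φ, φ)` for all smooth compactly supported sections `φ`. -/
def WeaklyLinearlyStable (N : Target) (Q : Plane → Fin 3 → ℝ) : Prop :=
  ∃ ρ : ℝ, 0 < ρ ∧ ∀ φ : Plane → Fin 3 → ℝ, IsTestSection N Q φ →
    ρ ^ 2 * hypIntegral (fun z => N.form (φ z) (φ z))
      ≤ hypIntegral (fun z => N.form (linOp N Q φ z) (φ z))

/-! ### The explicit maps -/

/-- `Q_λ(r, θ) = (2 arctan (λ tanh (r/2)), θ)` in polar coordinates: the point of the sphere with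
polar coordinates `(ρ, ϑ)` is `(sin ρ cos ϑ, sin ρ sin ϑ, cos ρ)`, and `(cos θ, sin θ) = z / |z|`
(the origin goes to `(0, 0, 1)`). -/
def sphereMap (lam : ℝ) (z : Plane) : Fin 3 → ℝ :=
  let ρ := 2 * Real.arctan (lam * Real.tanh (radius z / 2))
  ![Real.sin ρ * (z 0 / ‖z‖), Real.sin ρ * (z 1 / ‖z‖), Real.cos ρ]

/-- `P_λ(r, θ) = (2 arctanh (λ tanh (r/2)), θ)` in polar coordinates: the point of the hyperboloid
with polar coordinates `(ρ, ϑ)` is `(sinh ρ cos ϑ, sinh ρ sin ϑ, cosh ρ)`. -/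
def hyperbolicMap (lam : ℝ) (z : Plane) : Fin 3 → ℝ :=
  let ρ := 2 * Real.artanh (lam * Real.tanh (radius z / 2))
  ![Real.sinh ρ * (z 0 / ‖z‖), Real.sinh ρ * (z 1 / ‖z‖), Real.cosh ρ]

end HypHarmonic

end

open scoped ContDiff
open MeasureTheory

noncomputable section

namespace HypHarmonic

/-! ### Calculus of coordinate derivatives -/

/-! The Poincare metric is conformal to the flat one, and in dimension two the quadratic form of
`linOp` is conformally invariant. After integration by parts it is the flat integral of |∂φ|² -
κ|∂Q|²|φ|², taken with the ambient form: the squares (φ, ∂_jQ)² from the second fundamental form and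
from the curvature cancel (`form_linOp_mul_volDensity`). The hyperbolic volume remains only on the
mass side. So stability follows from a pointwise inequality modulo a compactly supported divergence
(`weaklyLinearlyStable_of_divergence`). The spectral gap comes from the Hardy inequality of the
disk. The field X = z/(1-|z|²) satisfies div X - |X|² ≥ 1/(1-|z|²)², one quarter of the volume
density (`hardy_pointwise`).

For the hyperbolic target the potential has the good sign. It dominates the normal part of ∂φ by
Cauchy-Schwarz, and the square |D_jφ + X_jφ|² gives the gap 1/4.

For the sphere the potential is destabilizing. A conformal Q is the inverse stereographic projection
of w = (a+ib)z, up to reflection. In the stereographic frame φ becomes a complex function f = A +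
iB, and modulo a divergence the energy is R²|2∂̄f|² with R = 1/(1+|w|²)
(`conformal_frame_identity`). As |w| is bounded on the disk, R² is bounded below there. Modulo the
null Lagrangian, |2∂̄f|² is |∇A|² + |∇B|², to which Hardy applies.

That every equivariant harmonic map to the sphere has this form is an ODE argument along rays
(`ray_solution`). The two parts of the Hopf differential, |tq'|² - |rot q|² and (tq', rot q), are
constant and vanish at the origin. The equation then drops to first order, and the stereographic
coordinate is linear in t. -/

lemma pd_add {j : Fin 2} {f g : Plane → ℝ} {z : Plane} (hf : DifferentiableAt ℝ f z)
    (hg : DifferentiableAt ℝ g z) : pd j (fun w => f w + g w) z = pd j f z + pd j g z := by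
  simp [pd, fderiv_fun_add hf hg]

lemma pd_sub {j : Fin 2} {f g : Plane → ℝ} {z : Plane} (hf : DifferentiableAt ℝ f z)
    (hg : DifferentiableAt ℝ g z) : pd j (fun w => f w - g w) z = pd j f z - pd j g z := by
  simp [pd, fderiv_fun_sub hf hg]

lemma pd_neg {j : Fin 2} {f : Plane → ℝ} {z : Plane} :
    pd j (fun w => -f w) z = -pd j f z := by
  simp [pd, fderiv_fun_neg]

lemma pd_mul {j : Fin 2} {f g : Plane → ℝ} {z : Plane} (hf : DifferentiableAt ℝ f z)
    (hg : DifferentiableAt ℝ g z) :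
    pd j (fun w => f w * g w) z = f z * pd j g z + g z * pd j f z := by
  simp [pd, fderiv_fun_mul hf hg]

lemma pd_pow_two {j : Fin 2} {f : Plane → ℝ} {z : Plane} (hf : DifferentiableAt ℝ f z) :
    pd j (fun w => f w ^ 2) z = 2 * f z * pd j f z := by
  simp only [pow_two, pd_mul hf hf]
  ring

lemma pd_inv {j : Fin 2} {f : Plane → ℝ} {z : Plane} (hf : DifferentiableAt ℝ f z)
    (h0 : f z ≠ 0) : pd j (fun w => (f w)⁻¹) z = -pd j f z / f z ^ 2 := by
  have : HasFDerivAt (fun w => (f w)⁻¹) ((-(f z ^ 2)⁻¹) • fderiv ℝ f z) z :=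
    (hasDerivAt_inv h0).comp_hasFDerivAt z hf.hasFDerivAt
  simp [pd, this.fderiv]
  ring

lemma pd_div {j : Fin 2} {f g : Plane → ℝ} {z : Plane} (hf : DifferentiableAt ℝ f z)
    (hg : DifferentiableAt ℝ g z) (h0 : g z ≠ 0) :
    pd j (fun w => f w / g w) z = (g z * pd j f z - f z * pd j g z) / g z ^ 2 := by
  simp only [div_eq_mul_inv]
  rw [pd_mul (g := fun w => (g w)⁻¹) hf (hg.inv h0), pd_inv hg h0]
  field_simp
  ring

lemma pd_const {j : Fin 2} {c : ℝ} {z : Plane} : pd j (fun _ => c) z = 0 := by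
  simp [pd]

lemma pd_coord {i j : Fin 2} {z : Plane} : pd j (fun w : Plane => w i) z = if i = j then 1 else 0 := by
  have : HasFDerivAt (fun w : Plane => w i)
      (EuclideanSpace.proj i : EuclideanSpace ℝ (Fin 2) →L[ℝ] ℝ) z :=
    (EuclideanSpace.proj i : EuclideanSpace ℝ (Fin 2) →L[ℝ] ℝ).hasFDerivAt
  simp [pd, this.fderiv]

lemma pd_apply {j : Fin 2} {f : Plane → Fin 3 → ℝ} {z : Plane} (hf : DifferentiableAt ℝ f z)
    (i : Fin 3) : pd j f z i = pd j (fun w => f w i) z := by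
  simp only [pd]
  have := (hasFDerivAt_pi'.1 hf.hasFDerivAt i).fderiv
  rw [this]
  rfl

lemma pd_congr {F : Type*} [NormedAddCommGroup F] [NormedSpace ℝ F] {j : Fin 2} {f g : Plane → F}
    {z : Plane} (h : f =ᶠ[nhds z] g) : pd j f z = pd j g z := by
  simp [pd, h.fderiv_eq]

lemma contDiffAt_pd {F : Type*} [NormedAddCommGroup F] [NormedSpace ℝ F] {j : Fin 2}
    {f : Plane → F} {z : Plane} (hf : ContDiffAt ℝ ∞ f z) : ContDiffAt ℝ ∞ (pd j f) z :=
  (hf.fderiv_right (m := ∞) (by simp)).clm_apply contDiffAt_const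

lemma contDiff_pd {F : Type*} [NormedAddCommGroup F] [NormedSpace ℝ F] {j : Fin 2}
    {f : Plane → F} (hf : ContDiff ℝ ∞ f) : ContDiff ℝ ∞ (pd j f) :=
  contDiff_iff_contDiffAt.2 fun _ => contDiffAt_pd hf.contDiffAt

lemma pd_comm {f : Plane → ℝ} {z : Plane} (hf : ContDiffAt ℝ ∞ f z) (i j : Fin 2) :
    pd i (pd j f) z = pd j (pd i f) z := by
  have hd : DifferentiableAt ℝ (fderiv ℝ f) z :=
    (hf.fderiv_right (m := ∞) (by simp)).differentiableAt (by simp)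
  have key : ∀ k l : Fin 2, pd k (pd l f) z
      = fderiv ℝ (fderiv ℝ f) z (EuclideanSpace.single k 1) (EuclideanSpace.single l 1) := by
    intro k l
    have := (hd.hasFDerivAt.clm_apply (hasFDerivAt_const (EuclideanSpace.single l (1 : ℝ)) z)).fderiv
    show fderiv ℝ (fun w => fderiv ℝ f w (EuclideanSpace.single l 1)) z _ = _
    rw [this]
    simp
  rw [key, key]
  exact (hf.isSymmSndFDerivAt (by simpa using WithTop.coe_le_coe.2 (le_top (a := (2 : ℕ∞))))) _ _

/-- The integral of a divergence of compact support vanishes. -/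
lemma integral_pd_eq_zero {f : Plane → ℝ} (hf : ContDiff ℝ ∞ f) (hc : HasCompactSupport f)
    (j : Fin 2) : ∫ z, pd j f z = 0 := by
  have hi : Integrable (pd j f) :=
    (contDiff_pd hf).continuous.integrable_of_hasCompactSupport
      (HasCompactSupport.fderiv_apply (𝕜 := ℝ) hc _)
  have := integral_mul_fderiv_eq_neg_fderiv_mul_of_integrable (μ := (volume : Measure Plane))
    (f := fun _ : Plane => (1 : ℝ)) (g := f) (v := EuclideanSpace.single j 1) (by simp)
    (by simpa [pd, Function.comp_def] using! hi)
    (by simpa using hf.continuous.integrable_of_hasCompactSupport hc) (by simp)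
    (fun x _ => hf.differentiable (by simp) x)
  simpa [pd] using this

/-! ### The domain -/

lemma isOpen_disk : IsOpen disk := Metric.isOpen_ball

lemma norm_sq_eq (z : Plane) : ‖z‖ ^ 2 = z 0 ^ 2 + z 1 ^ 2 := by
  simp [EuclideanSpace.real_norm_sq_eq, Fin.sum_univ_two]

lemma mem_disk {z : Plane} : z ∈ disk ↔ z 0 ^ 2 + z 1 ^ 2 < 1 := by
  rw [← norm_sq_eq]
  simp [disk]

lemma volDensity_eq (z : Plane) : volDensity z = 4 / (1 - (z 0 ^ 2 + z 1 ^ 2)) ^ 2 := by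
  have h : (metric z).det = (4 / (1 - (z 0 ^ 2 + z 1 ^ 2)) ^ 2) ^ 2 := by
    simp [metric, norm_sq_eq]
  rw [volDensity, h, Real.sqrt_sq (by positivity)]

lemma volDensity_pos {z : Plane} (hz : z ∈ disk) : 0 < volDensity z := by
  rw [volDensity_eq]
  have := mem_disk.1 hz
  have : 0 < 1 - (z 0 ^ 2 + z 1 ^ 2) := by linarith
  positivity

lemma metric_eq (z : Plane) : metric z = volDensity z • (1 : Matrix (Fin 2) (Fin 2) ℝ) := by
  rw [volDensity_eq, metric, norm_sq_eq]

lemma metric_inv {z : Plane} (hz : z ∈ disk) :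
    (metric z)⁻¹ = (volDensity z)⁻¹ • (1 : Matrix (Fin 2) (Fin 2) ℝ) := by
  rw [metric_eq]
  have h := (volDensity_pos hz).ne'
  apply Matrix.inv_eq_left_inv
  simp [smul_smul, h]

/-- For a conformal metric in dimension n this trace is proportional to n - 2. It is the reason why
the divergence below has no first-order term. -/
lemma trace_christoffel {z : Plane} (hz : z ∈ disk) (l : Fin 2) :
    christoffel l 0 0 z + christoffel l 1 1 z = 0 := by
  have h : ∀ i j k : Fin 2, pd i (fun w => metric w j k) z
      = if j = k then pd i volDensity z else 0 := by
    intro i j k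
    split_ifs with hjk
    · simp [metric_eq, hjk]
    · simp [metric_eq, hjk, pd_const]
  simp only [christoffel, h, metric_inv hz, Fin.sum_univ_two]
  fin_cases l <;> simp

/-- The divergence on the hyperbolic plane is conformal to the flat one. -/
lemma covDiv_eq (N : Target) (Q : Plane → Fin 3 → ℝ) (Ψ : Fin 2 → Plane → Fin 3 → ℝ) {z : Plane}
    (hz : z ∈ disk) :
    covDiv N Q Ψ z = (volDensity z)⁻¹ • ∑ j, covDeriv N Q j (Ψ j) z := by
  have h0 := trace_christoffel hz 0
  have h1 := trace_christoffel hz 1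
  ext i
  simp [covDiv, metric_inv hz, Fin.sum_univ_two]
  linear_combination (volDensity z)⁻¹ * (-Ψ 0 z i * h0 - Ψ 1 z i * h1)

/-! ### The targets -/

namespace Target

lemma curv_sq (N : Target) : N.curv ^ 2 = 1 := by cases N <;> simp [curv]

lemma form_self_of_mem {N : Target} {y : Fin 3 → ℝ} (hy : y ∈ N.carrier) :
    N.form y y = N.curv := by
  cases N
  · simpa [carrier, curv] using hy
  · simpa [carrier, curv] using hy.1

end Target

/-- The bilinear form along two maps, differentiated. -/
lemma pd_form (N : Target) {j : Fin 2} {f g : Plane → Fin 3 → ℝ} {z : Plane}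
    (hf : DifferentiableAt ℝ f z) (hg : DifferentiableAt ℝ g z) :
    pd j (fun w => N.form (f w) (g w)) z
      = N.form (pd j f z) (g z) + N.form (f z) (pd j g z) := by
  have hf' := differentiableAt_pi.1 hf
  have hg' := differentiableAt_pi.1 hg
  simp only [Target.form, pd_apply hf, pd_apply hg]
  have := hf' 0; have := hf' 1; have := hf' 2
  have := hg' 0; have := hg' 1; have := hg' 2
  simp (disch := fun_prop) only [pd_add, pd_mul, pd_const]
  ring

lemma ContDiffAt.form (N : Target) {f g : Plane → Fin 3 → ℝ} {z : Plane}
    (hf : ContDiffAt ℝ ∞ f z) (hg : ContDiffAt ℝ ∞ g z) :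
    ContDiffAt ℝ ∞ (fun w => N.form (f w) (g w)) z := by
  have hf' := contDiffAt_pi.1 hf
  have hg' := contDiffAt_pi.1 hg
  simp only [Target.form]
  exact (((hf' 0).mul (hg' 0)).add ((hf' 1).mul (hg' 1))).add
    (contDiffAt_const.mul ((hf' 2).mul (hg' 2)))

/-- The density of the quadratic form of the linearized operator, in flat coordinates. -/
lemma form_linOp_mul_volDensity {N : Target} {Q φ : Plane → Fin 3 → ℝ} (hQ : IsSmoothMap N Q)
    (hφ : IsTestSection N Q φ) {z : Plane} (hz : z ∈ disk) :
    N.form (linOp N Q φ z) (φ z) * volDensity z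
      = -∑ j, N.form (pd j (pd j φ) z) (φ z)
        - N.curv * (∑ j, N.form (pd j Q z) (pd j Q z)) * N.form (φ z) (φ z) := by
  have hv := (volDensity_pos hz).ne'
  have hQz : ContDiffAt ℝ ∞ Q z := hQ.1.contDiffAt (isOpen_disk.mem_nhds hz)
  have hφz : ContDiffAt ℝ ∞ φ z := hφ.smooth.contDiffAt
  have hκ := N.curv_sq
  have hQd := hQz.differentiableAt (n := ∞) (by simp)
  have hφd := hφz.differentiableAt (n := ∞) (by simp)
  have hpφd : ∀ j, DifferentiableAt ℝ (pd j φ) z := fun j =>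
    (contDiffAt_pd hφz).differentiableAt (n := ∞) (by simp)
  have htan := hφ.tangent z hz
  have hdtan : ∀ j, N.form (pd j φ z) (Q z) = -N.form (φ z) (pd j Q z) := by
    intro j
    have h1 : pd j (fun w => N.form (φ w) (Q w)) z = 0 := by
      rw [pd_congr (g := fun _ => (0 : ℝ)), pd_const]
      filter_upwards [isOpen_disk.mem_nhds hz] with w hw using hφ.tangent w hw
    rw [pd_form N hφd hQd] at h1
    linarith
  have hDD : ∀ j, N.form (covDeriv N Q j (fun w => covDeriv N Q j φ w) z) (φ z)
      = N.form (pd j (pd j φ) z) (φ z) + N.curv * N.form (φ z) (pd j Q z) ^ 2 := by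
    intro j
    have hsc : DifferentiableAt ℝ (fun w => N.curv * N.form (pd j φ w) (Q w)) z :=
      (contDiffAt_const.mul (ContDiffAt.form N (contDiffAt_pd hφz) hQz)).differentiableAt
        (n := ∞) (by simp)
    have hcov : pd j (fun w => covDeriv N Q j φ w) z = pd j (pd j φ) z
        - ((N.curv * N.form (pd j φ z) (Q z)) • pd j Q z
          + pd j (fun w => N.curv * N.form (pd j φ w) (Q w)) z • Q z) := by
      show fderiv ℝ (fun w => pd j φ w - (N.curv * N.form (pd j φ w) (Q w)) • Q w) z _ = _
      rw [fderiv_fun_sub (hpφd j) (hsc.fun_smul hQd), fderiv_fun_smul hsc hQd]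
      rfl
    have htan' : N.form (Q z) (φ z) = 0 := by
      rw [← htan]; simp only [Target.form]; ring
    have hdt := hdtan j
    rw [covDeriv, hcov]
    -- The derivative of the normal coefficient is never computed: it multiplies `Q z`, which is
    -- orthogonal to `φ z`.
    generalize pd j (fun w => N.curv * N.form (pd j φ w) (Q w)) z = c
    generalize hd : N.form (pd j φ z) (Q z) = d at hdt ⊢
    simp only [Target.proj, Target.form, Pi.sub_apply, Pi.add_apply, Pi.smul_apply, smul_eq_mul]
      at htan' hdt ⊢
    subst hdt
    linear_combination (-c - N.curv * (
      (pd j (pd j φ) z 0 - (N.curv * -(φ z 0 * pd j Q z 0 + φ z 1 * pd j Q z 1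
        + N.curv * (φ z 2 * pd j Q z 2)) * pd j Q z 0 + c * Q z 0)) * Q z 0 +
      (pd j (pd j φ) z 1 - (N.curv * -(φ z 0 * pd j Q z 0 + φ z 1 * pd j Q z 1
        + N.curv * (φ z 2 * pd j Q z 2)) * pd j Q z 1 + c * Q z 1)) * Q z 1 +
      N.curv * ((pd j (pd j φ) z 2 - (N.curv * -(φ z 0 * pd j Q z 0 + φ z 1 * pd j Q z 1
        + N.curv * (φ z 2 * pd j Q z 2)) * pd j Q z 2 + c * Q z 2)) * Q z 2))) * htan'
  have h0 := hDD 0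
  have h1 := hDD 1
  simp only [linOp, covDiv_eq N Q _ hz, metric_inv hz, Fin.sum_univ_two, Target.riem]
  generalize covDeriv N Q 0 (fun w => covDeriv N Q 0 φ w) z = A at *
  generalize covDeriv N Q 1 (fun w => covDeriv N Q 1 φ w) z = B at *
  simp [Target.form] at h0 h1 ⊢
  field_simp
  -- The squares (φ, ∂_jQ)² in `h0` and `h1` cancel those of the curvature term.
  linear_combination -h0 - h1

/-! ### Stability from a pointwise inequality up to a divergence -/

/-- Needed because the Hardy field blows up at the unit circle: global smoothness comes from the
support being compact inside the disk. -/
lemma contDiff_of_eq_zero_off {f : Plane → ℝ} {K : Set Plane} (hf : ContDiffOn ℝ ∞ f disk)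
    (hK : IsClosed K) (hKd : K ⊆ disk) (h0 : ∀ z ∉ K, f z = 0) : ContDiff ℝ ∞ f := by
  rw [contDiff_iff_contDiffAt]
  intro z
  by_cases hz : z ∈ disk
  · exact hf.contDiffAt (isOpen_disk.mem_nhds hz)
  · apply (contDiffAt_const (c := (0 : ℝ))).congr_of_eventuallyEq
    filter_upwards [hK.isOpen_compl.mem_nhds (fun h => hz (hKd h))] with w hw using h0 w hw

lemma integrableOn_disk {f : Plane → ℝ} {K : Set Plane} (hf : ContinuousOn f disk)
    (hK : IsCompact K) (hKd : K ⊆ disk) (h0 : ∀ z ∉ K, f z = 0) : IntegrableOn f disk :=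
  ((hf.mono hKd).integrableOn_compact hK).of_forall_sdiff_eq_zero isOpen_disk.measurableSet
    fun z hz => h0 z hz.2

lemma continuousOn_volDensity : ContinuousOn volDensity disk := by
  have : volDensity = fun z => 4 / (1 - ‖z‖ ^ 2) ^ 2 := by
    ext z
    rw [volDensity_eq, norm_sq_eq]
  rw [this]
  refine continuousOn_const.div (by fun_prop) fun z hz => ?_
  have := mem_disk.1 hz
  rw [← norm_sq_eq] at this
  have : 0 < 1 - ‖z‖ ^ 2 := by linarith
  positivity

/-- Divergences of compact support integrate to zero, so the inequality is only needed up to one.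
The right-hand side already has |∂φ|² in place of -(Δφ, φ), the difference being a divergence too.
-/
lemma weaklyLinearlyStable_of_divergence {N : Target} {Q : Plane → Fin 3 → ℝ}
    (hQ : IsSmoothMap N Q) {ρ : ℝ} (hρ : 0 < ρ)
    (h : ∀ φ, IsTestSection N Q φ → ∃ Z : Fin 2 → Plane → ℝ, (∀ j, ContDiffOn ℝ ∞ (Z j) disk) ∧
      (∀ j, ∀ z ∉ tsupport φ, Z j z = 0) ∧
      ∀ z ∈ disk, ρ ^ 2 * (N.form (φ z) (φ z) * volDensity z) + ∑ j, pd j (Z j) z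
        ≤ ∑ j, N.form (pd j φ z) (pd j φ z)
          - N.curv * (∑ j, N.form (pd j Q z) (pd j Q z)) * N.form (φ z) (φ z)) :
    WeaklyLinearlyStable N Q := by
  refine ⟨ρ, hρ, fun φ hφ => ?_⟩
  obtain ⟨Z, hZs, hZ0, hZ⟩ := h φ hφ
  have hφ0 : ∀ z ∉ tsupport φ, φ z = 0 := fun z hz => image_eq_zero_of_notMem_tsupport hz
  have hK : IsCompact (tsupport φ) := hφ.compactSupport
  -- The added term has divergence -(Δφ, φ) - |∂φ|², which performs the integration by parts
  -- together with that of `Z`.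
  set Y : Fin 2 → Plane → ℝ := fun j z => Z j z - N.form (pd j φ z) (φ z) with hY
  have hYs : ∀ j, ContDiff ℝ ∞ (Y j) := fun j =>
    contDiff_of_eq_zero_off
      (fun z hz => ((hZs j).contDiffAt (isOpen_disk.mem_nhds hz)).contDiffWithinAt.sub
        (ContDiffAt.form N (contDiffAt_pd hφ.smooth.contDiffAt)
          hφ.smooth.contDiffAt).contDiffWithinAt)
      (isClosed_tsupport φ) hφ.support_subset
      (fun z hz => by simp [Y, hZ0 j z hz, hφ0 z hz, Target.form])
  have hYc : ∀ j, HasCompactSupport (Y j) := fun j =>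
    HasCompactSupport.intro hK
      (fun z hz => by simp [Y, hZ0 j z hz, hφ0 z hz, Target.form])
  have hY0 : ∀ j, ∀ z ∉ tsupport φ, pd j (Y j) z = 0 := by
    intro j z hz
    rw [pd_congr (g := fun _ => 0), pd_const]
    filter_upwards [(isClosed_tsupport φ).isOpen_compl.mem_nhds hz] with w hw
    simp [Y, hZ0 j w hw, hφ0 w hw, Target.form]
  have hYi : ∀ j, ∫ z in disk, pd j (Y j) z = 0 := by
    intro j
    rw [setIntegral_eq_integral_of_forall_compl_eq_zero, integral_pd_eq_zero (hYs j) (hYc j)]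
    exact fun z hz => hY0 j z fun h => hz (hφ.support_subset h)
  have hYI : ∀ j, IntegrableOn (pd j (Y j)) disk := fun j =>
    integrableOn_disk (contDiff_pd (hYs j)).continuous.continuousOn hK hφ.support_subset (hY0 j)
  have hform : ∀ f : Plane → Fin 3 → ℝ, ContDiffOn ℝ ∞ f disk → ∀ g : Plane → Fin 3 → ℝ,
      ContDiffOn ℝ ∞ g disk → ContinuousOn (fun z => N.form (f z) (g z)) disk :=
    fun f hf g hg z hz => (ContDiffAt.form N (hf.contDiffAt (isOpen_disk.mem_nhds hz))
      (hg.contDiffAt (isOpen_disk.mem_nhds hz))).continuousAt.continuousWithinAt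
  have hpQ : ∀ j, ContDiffOn ℝ ∞ (pd j Q) disk := fun j z hz =>
    (contDiffAt_pd (hQ.1.contDiffAt (isOpen_disk.mem_nhds hz))).contDiffWithinAt
  have hL : IntegrableOn (fun z => N.form (φ z) (φ z) * volDensity z) disk :=
    integrableOn_disk ((hform φ hφ.smooth.contDiffOn φ hφ.smooth.contDiffOn).mul
      continuousOn_volDensity) hK hφ.support_subset
      (fun z hz => by simp [hφ0 z hz, Target.form])
  have hR : IntegrableOn (fun z => N.form (linOp N Q φ z) (φ z) * volDensity z) disk := by
    refine integrableOn_disk (ContinuousOn.congr ?_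
      fun z hz => form_linOp_mul_volDensity hQ hφ hz) hK hφ.support_subset
      (fun z hz => by simp [hφ0 z hz, Target.form])
    refine ((continuousOn_finsetSum _ fun j _ => hform _ (contDiff_pd
      (contDiff_pd hφ.smooth)).contDiffOn _ hφ.smooth.contDiffOn).neg).sub
      ((continuousOn_const.mul (continuousOn_finsetSum _ fun j _ => hform _ (hpQ j) _ (hpQ j))).mul
      (hform φ hφ.smooth.contDiffOn φ hφ.smooth.contDiffOn))
  have key : ∫ z in disk, (ρ ^ 2 * (N.form (φ z) (φ z) * volDensity z)
      + (pd 0 (Y 0) z + pd 1 (Y 1) z))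
      ≤ ∫ z in disk, N.form (linOp N Q φ z) (φ z) * volDensity z := by
    refine setIntegral_mono_on ((hL.const_mul _).add ((hYI 0).add (hYI 1))) hR
      isOpen_disk.measurableSet fun z hz => ?_
    have hφd := hφ.smooth.contDiffAt.differentiableAt (x := z) (by simp)
    have hpY : ∀ j, pd j (Y j) z = pd j (Z j) z - (N.form (pd j (pd j φ) z) (φ z)
        + N.form (pd j φ z) (pd j φ z)) := by
      intro j
      have hpφd := (contDiffAt_pd (j := j) hφ.smooth.contDiffAt).differentiableAt (x := z) (by simp)
      have h1 : DifferentiableAt ℝ (Z j) z :=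
        ((hZs j).contDiffAt (isOpen_disk.mem_nhds hz)).differentiableAt (by simp)
      have h2 : DifferentiableAt ℝ (fun w => N.form (pd j φ w) (φ w)) z :=
        (ContDiffAt.form N (contDiffAt_pd hφ.smooth.contDiffAt)
          hφ.smooth.contDiffAt).differentiableAt (by simp)
      rw [hY, pd_sub h1 h2, pd_form N hpφd hφd]
    have := hZ z hz
    rw [form_linOp_mul_volDensity hQ hφ hz, hpY, hpY]
    simp only [Fin.sum_univ_two] at this ⊢
    linarith
  rw [integral_add (g := fun z => pd 0 (Y 0) z + pd 1 (Y 1) z) (hL.const_mul _)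
    ((hYI 0).add (hYI 1)), integral_add (hYI 0) (hYI 1), hYi, hYi, integral_const_mul] at key
  simpa [hypIntegral] using key

/-! ### The radial vector field of the Hardy inequality -/

/-- The vector field `z / (1 - |z|²)`. -/
def hardyField (j : Fin 2) (z : Plane) : ℝ := z j / (1 - (z 0 ^ 2 + z 1 ^ 2))

lemma contDiffAt_hardyField {j : Fin 2} {z : Plane} (hz : z ∈ disk) :
    ContDiffAt ℝ ∞ (hardyField j) z := by
  have := mem_disk.1 hz
  have h : (1 : ℝ) - (z 0 ^ 2 + z 1 ^ 2) ≠ 0 := by linarith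
  unfold hardyField
  fun_prop (disch := exact h)

lemma pd_hardyField {z : Plane} (hz : z ∈ disk) (j : Fin 2) :
    pd j (hardyField j) z
      = ((1 - (z 0 ^ 2 + z 1 ^ 2)) + 2 * z j ^ 2) / (1 - (z 0 ^ 2 + z 1 ^ 2)) ^ 2 := by
  have := mem_disk.1 hz
  have h : (1 : ℝ) - (z 0 ^ 2 + z 1 ^ 2) ≠ 0 := by linarith
  have hd : DifferentiableAt ℝ (fun w : Plane => 1 - (w 0 ^ 2 + w 1 ^ 2)) z := by fun_prop
  have hc : DifferentiableAt ℝ (fun w : Plane => w j) z := by fun_prop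
  unfold hardyField
  rw [pd_div hc hd h]
  simp (disch := fun_prop) only [pd_sub, pd_add, pd_pow_two, pd_const, pd_coord]
  fin_cases j <;> simp <;> ring

/-- Completing the square against `hardyField`, for a nonnegative density `G`. -/
lemma hardy_pointwise {G : Plane → ℝ} {z : Plane} (hz : z ∈ disk) (hG : DifferentiableAt ℝ G z)
    (hG0 : 0 ≤ G z) :
    G z / (1 - (z 0 ^ 2 + z 1 ^ 2)) ^ 2 + ∑ j, pd j (fun w => -(hardyField j w * G w)) z
      ≤ ∑ j, (-(hardyField j z * pd j G z) - hardyField j z ^ 2 * G z) := by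
  have hX : ∀ j, DifferentiableAt ℝ (hardyField j) z := fun j =>
    (contDiffAt_hardyField hz).differentiableAt (by simp)
  have := mem_disk.1 hz
  have h : (0 : ℝ) < 1 - (z 0 ^ 2 + z 1 ^ 2) := by linarith
  have hpd : ∀ j, pd j (fun w => -(hardyField j w * G w)) z
      = -(hardyField j z * pd j G z + G z * pd j (hardyField j) z) := by
    intro j
    rw [pd_neg, pd_mul (hX j) hG]
  simp only [hpd, Fin.sum_univ_two, pd_hardyField hz]
  simp only [hardyField]
  -- With s = |z|², div X - |X|² = (2 - s)/(1 - s)². This is its excess over 1/(1 - s)², times `G`.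
  have : 0 ≤ G z * (1 - (z 0 ^ 2 + z 1 ^ 2)) / (1 - (z 0 ^ 2 + z 1 ^ 2)) ^ 2 := by positivity
  rw [← sub_nonneg]
  convert this using 1
  field_simp
  ring

/-! ### Hyperbolic target -/

namespace Target

/-- The tangent planes of the hyperboloid are spacelike: tangency makes v₂y₂ a horizontal inner
product, and horizontal Cauchy-Schwarz with y₀² + y₁² = y₂² - 1 concludes. -/
lemma form_nonneg_of_tangent {y v : Fin 3 → ℝ} (hy : hyperbolic.form y y = -1)
    (hv : hyperbolic.form v y = 0) : 0 ≤ hyperbolic.form v v := by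
  simp only [form, curv] at *
  have h1 : (v 2 * y 2) ^ 2 ≤ (v 0 ^ 2 + v 1 ^ 2) * (y 2 ^ 2 - 1) := by
    have h2 : v 2 * y 2 = v 0 * y 0 + v 1 * y 1 := by linarith
    have h3 : y 2 ^ 2 - 1 = y 0 ^ 2 + y 1 ^ 2 := by linarith
    rw [h2, h3]
    nlinarith [sq_nonneg (v 0 * y 1 - v 1 * y 0)]
  have h2 : 0 < y 2 ^ 2 := by nlinarith [sq_nonneg (y 0), sq_nonneg (y 1)]
  have h3 : 0 ≤ (v 0 ^ 2 + v 1 ^ 2 - v 2 ^ 2) * y 2 ^ 2 := by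
    nlinarith [sq_nonneg (v 0), sq_nonneg (v 1)]
  have := nonneg_of_mul_nonneg_left h3 h2
  linarith

/-- Cauchy-Schwarz on a tangent plane, from the discriminant of t ↦ (tv + w, tv + w) ≥ 0. -/
lemma form_sq_le_of_tangent {y v w : Fin 3 → ℝ} (hy : hyperbolic.form y y = -1)
    (hv : hyperbolic.form v y = 0) (hw : hyperbolic.form w y = 0) :
    hyperbolic.form v w ^ 2 ≤ hyperbolic.form v v * hyperbolic.form w w := by
  have h : ∀ t : ℝ, 0 ≤ hyperbolic.form v v * (t * t) + (2 * hyperbolic.form v w) * t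
      + hyperbolic.form w w := by
    intro t
    have h1 : hyperbolic.form (t • v + w) y = 0 := by
      simp only [form, Pi.add_apply, Pi.smul_apply, smul_eq_mul] at *
      linear_combination t * hv + hw
    have := form_nonneg_of_tangent hy h1
    simp only [form, Pi.add_apply, Pi.smul_apply, smul_eq_mul] at *
    linarith
  have := discrim_le_zero h
  rw [discrim] at this
  linarith

end Target

lemma form_pd_self_of_mem {N : Target} {Q : Plane → Fin 3 → ℝ} (hQ : IsSmoothMap N Q) {z : Plane}
    (hz : z ∈ disk) (j : Fin 2) : N.form (pd j Q z) (Q z) = 0 := by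
  have hQd : DifferentiableAt ℝ Q z :=
    (hQ.1.contDiffAt (isOpen_disk.mem_nhds hz)).differentiableAt (by simp)
  have h1 : pd j (fun w => N.form (Q w) (Q w)) z = 0 := by
    rw [pd_congr (g := fun _ => N.curv), pd_const]
    filter_upwards [isOpen_disk.mem_nhds hz] with w hw
      using Target.form_self_of_mem (hQ.2 w hw)
  rw [pd_form N hQd hQd] at h1
  simp only [Target.form] at *
  linarith

/-- Every smooth map into the hyperbolic plane is weakly linearly stable. -/
theorem weaklyLinearlyStable_hyperbolic {Q : Plane → Fin 3 → ℝ}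
    (hQ : IsSmoothMap Target.hyperbolic Q) : WeaklyLinearlyStable Target.hyperbolic Q := by
  -- The constant ρ² = 1/4 turns the volume density into the Hardy weight 1/(1-|z|²)².
  refine weaklyLinearlyStable_of_divergence hQ (ρ := 1 / 2) (by norm_num) fun φ hφ => ?_
  set G : Plane → ℝ := fun z => Target.hyperbolic.form (φ z) (φ z) with hG
  refine ⟨fun j z => -(hardyField j z * G z), fun j z hz => ?_, fun j z hz => ?_, fun z hz => ?_⟩
  · exact (((contDiffAt_hardyField hz).mul (ContDiffAt.form _ hφ.smooth.contDiffAt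
      hφ.smooth.contDiffAt)).neg).contDiffWithinAt
  · simp [G, image_eq_zero_of_notMem_tsupport hz, Target.form]
  · have hφd := hφ.smooth.contDiffAt.differentiableAt (x := z) (by simp)
    have hy : Target.hyperbolic.form (Q z) (Q z) = -1 := Target.form_self_of_mem (hQ.2 z hz)
    have hφt := hφ.tangent z hz
    have hGd : DifferentiableAt ℝ G z := (ContDiffAt.form _ hφ.smooth.contDiffAt
      hφ.smooth.contDiffAt).differentiableAt (by simp)
    have hpt := hardy_pointwise hz hGd (Target.form_nonneg_of_tangent hy hφt)
    have hsq : ∀ j, -(hardyField j z * pd j G z) - hardyField j z ^ 2 * G z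
        ≤ Target.hyperbolic.form (pd j φ z) (pd j φ z)
          + Target.hyperbolic.form (pd j Q z) (pd j Q z) * G z := by
      intro j
      have hQt := form_pd_self_of_mem hQ hz j
      have hcs := Target.form_sq_le_of_tangent hy hQt hφt
      have hdt : Target.hyperbolic.form (pd j φ z) (Q z)
          = -Target.hyperbolic.form (pd j Q z) (φ z) := by
        have hQd : DifferentiableAt ℝ Q z :=
          (hQ.1.contDiffAt (isOpen_disk.mem_nhds hz)).differentiableAt (by simp)
        have h1 : pd j (fun w => Target.hyperbolic.form (φ w) (Q w)) z = 0 := by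
          rw [pd_congr (g := fun _ => (0 : ℝ)), pd_const]
          filter_upwards [isOpen_disk.mem_nhds hz] with w hw using hφ.tangent w hw
        rw [pd_form _ hφd hQd] at h1
        simp only [Target.form] at *
        linarith
      rw [hG, pd_form _ hφd hφd]
      generalize hardyField j z = x
      -- The vector is D_jφ + X_jφ; since (Q, Q) = -1, the tangential projection adds (∂_jφ, Q)Q.
      -- The resulting (∂_jφ, Q)² = (∂_jQ, φ)² is absorbed by the potential through `hcs`.
      have hpos := Target.form_nonneg_of_tangent hy (v := pd j φ z
        + Target.hyperbolic.form (pd j φ z) (Q z) • Q z + x • φ z) (by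
          simp only [Target.form, Target.curv, Pi.add_apply, Pi.smul_apply, smul_eq_mul] at *
          linear_combination (pd j φ z 0 * Q z 0 + pd j φ z 1 * Q z 1
            + -1 * (pd j φ z 2 * Q z 2)) * hy + x * hφt)
      have hexp : Target.hyperbolic.form (pd j φ z
          + Target.hyperbolic.form (pd j φ z) (Q z) • Q z + x • φ z) (pd j φ z
          + Target.hyperbolic.form (pd j φ z) (Q z) • Q z + x • φ z)
          = Target.hyperbolic.form (pd j φ z) (pd j φ z)
            + Target.hyperbolic.form (pd j φ z) (Q z) ^ 2
            + 2 * x * Target.hyperbolic.form (pd j φ z) (φ z)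
            + x ^ 2 * Target.hyperbolic.form (φ z) (φ z) := by
        generalize hd : Target.hyperbolic.form (pd j φ z) (Q z) = d
        simp only [Target.form, Target.curv, Pi.add_apply, Pi.smul_apply, smul_eq_mul] at *
        linear_combination d ^ 2 * hy + 2 * d * hd + 2 * d * x * hφt
      rw [hexp, hdt] at hpos
      have hsymm : Target.hyperbolic.form (φ z) (pd j φ z)
          = Target.hyperbolic.form (pd j φ z) (φ z) := by simp only [Target.form]; ring
      rw [hsymm]
      linarith
    have h0 := hsq 0
    have h1 := hsq 1
    have hv : (1 / 2 : ℝ) ^ 2 * (Target.hyperbolic.form (φ z) (φ z) * volDensity z)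
        = G z / (1 - (z 0 ^ 2 + z 1 ^ 2)) ^ 2 := by
      rw [volDensity_eq]
      ring
    rw [hv]
    simp only [Fin.sum_univ_two, Target.curv] at hpt ⊢
    linarith

/-! ### Conformal maps to the sphere -/

/-- First coordinate of the complex multiplication `z ↦ (a + i b) z`. -/
def mulRe (a b : ℝ) (z : Plane) : ℝ := a * z 0 - b * z 1

/-- Second coordinate of the complex multiplication `z ↦ (a + i b) z`. -/
def mulIm (a b : ℝ) (z : Plane) : ℝ := b * z 0 + a * z 1

/-- The factor `1 / (1 + |w|²)` of the inverse stereographic projection at `w = (a + i b) z`. -/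
def stereoFactor (a b : ℝ) (z : Plane) : ℝ := (1 + mulRe a b z ^ 2 + mulIm a b z ^ 2)⁻¹

/-- The inverse stereographic projection of `(a + i b) z`, reflected if `ε = -1`. -/
def conformalMap (a b ε : ℝ) (z : Plane) : Fin 3 → ℝ :=
  ![2 * mulRe a b z * stereoFactor a b z, 2 * mulIm a b z * stereoFactor a b z,
    ε * (2 * stereoFactor a b z - 1)]

section

variable {a b ε : ℝ} {z : Plane}

lemma contDiff_mulRe : ContDiff ℝ ∞ (mulRe a b) := by
  unfold mulRe
  fun_prop

lemma contDiff_mulIm : ContDiff ℝ ∞ (mulIm a b) := by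
  unfold mulIm
  fun_prop

lemma stereoFactor_pos : 0 < stereoFactor a b z := by
  unfold stereoFactor
  positivity

lemma stereoFactor_mul : stereoFactor a b z * (1 + mulRe a b z ^ 2 + mulIm a b z ^ 2) = 1 :=
  inv_mul_cancel₀ (by positivity)

lemma stereoFactor_le_one : stereoFactor a b z ≤ 1 :=
  inv_le_one_of_one_le₀ (by nlinarith [sq_nonneg (mulRe a b z), sq_nonneg (mulIm a b z)])

lemma mulRe_sq_add_mulIm_sq :
    mulRe a b z ^ 2 + mulIm a b z ^ 2 = (a ^ 2 + b ^ 2) * (z 0 ^ 2 + z 1 ^ 2) := by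
  simp only [mulRe, mulIm]
  ring

/-- On the disk |w|² < a² + b², so the image stays away from the antipode of the image of the
origin. This uniform bound makes the stability constant positive. -/
lemma le_stereoFactor (hz : z ∈ disk) : (1 + (a ^ 2 + b ^ 2))⁻¹ ≤ stereoFactor a b z := by
  have := mem_disk.1 hz
  refine inv_anti₀ (by positivity) ?_
  rw [add_assoc, mulRe_sq_add_mulIm_sq]
  nlinarith [mul_nonneg (add_nonneg (sq_nonneg a) (sq_nonneg b)) (sub_nonneg.2 this.le)]

lemma contDiff_stereoFactor : ContDiff ℝ ∞ (stereoFactor a b) := by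
  have h1 := contDiff_mulRe (a := a) (b := b)
  have h2 := contDiff_mulIm (a := a) (b := b)
  exact ContDiff.inv (by fun_prop) fun z => by positivity

lemma pd_zero_mulRe : pd 0 (mulRe a b) z = a := by
  unfold mulRe
  simp (disch := fun_prop) only [pd_sub, pd_mul, pd_const, pd_coord]
  simp

lemma pd_one_mulRe : pd 1 (mulRe a b) z = -b := by
  unfold mulRe
  simp (disch := fun_prop) only [pd_sub, pd_mul, pd_const, pd_coord]
  simp

lemma pd_zero_mulIm : pd 0 (mulIm a b) z = b := by
  unfold mulIm
  simp (disch := fun_prop) only [pd_add, pd_mul, pd_const, pd_coord]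
  simp

lemma pd_one_mulIm : pd 1 (mulIm a b) z = a := by
  unfold mulIm
  simp (disch := fun_prop) only [pd_add, pd_mul, pd_const, pd_coord]
  simp

lemma pd_stereoFactor (j : Fin 2) : pd j (stereoFactor a b) z
    = -(2 * mulRe a b z * pd j (mulRe a b) z + 2 * mulIm a b z * pd j (mulIm a b) z)
      * stereoFactor a b z ^ 2 := by
  have h1 : DifferentiableAt ℝ (mulRe a b) z := contDiff_mulRe.differentiable (by simp) z
  have h2 : DifferentiableAt ℝ (mulIm a b) z := contDiff_mulIm.differentiable (by simp) z
  have h3 : 1 + mulRe a b z ^ 2 + mulIm a b z ^ 2 ≠ 0 := by positivity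
  show pd j (fun w => (1 + mulRe a b w ^ 2 + mulIm a b w ^ 2)⁻¹) z = _
  rw [pd_inv (by fun_prop) h3]
  simp (disch := fun_prop) only [pd_add, pd_pow_two, pd_const]
  rw [stereoFactor]
  field_simp
  ring

lemma contDiff_conformalMap : ContDiff ℝ ∞ (conformalMap a b ε) := by
  have h1 := contDiff_mulRe (a := a) (b := b)
  have h2 := contDiff_mulIm (a := a) (b := b)
  have h3 := contDiff_stereoFactor (a := a) (b := b)
  rw [contDiff_pi]
  intro i
  fin_cases i <;> simp only [conformalMap, Fin.zero_eta, Fin.mk_one, Fin.reduceFinMk,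
    Matrix.cons_val] <;> fun_prop

lemma form_conformalMap (hε : ε ^ 2 = 1) :
    Target.sphere.form (conformalMap a b ε z) (conformalMap a b ε z) = 1 := by
  have h := stereoFactor_mul (a := a) (b := b) (z := z)
  simp only [Target.form, Target.curv, conformalMap, Matrix.cons_val]
  linear_combination (4 * stereoFactor a b z) * h + (2 * stereoFactor a b z - 1) ^ 2 * hε

lemma energy_conformalMap (hε : ε ^ 2 = 1) :
    ∑ j, Target.sphere.form (pd j (conformalMap a b ε) z) (pd j (conformalMap a b ε) z)
      = 8 * (a ^ 2 + b ^ 2) * stereoFactor a b z ^ 2 := by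
  have hd : DifferentiableAt ℝ (conformalMap a b ε) z :=
    contDiff_conformalMap.differentiable (by simp) z
  have h1 : DifferentiableAt ℝ (mulRe a b) z := contDiff_mulRe.differentiable (by simp) z
  have h2 : DifferentiableAt ℝ (mulIm a b) z := contDiff_mulIm.differentiable (by simp) z
  have h3 : DifferentiableAt ℝ (stereoFactor a b) z :=
    contDiff_stereoFactor.differentiable (by simp) z
  have h := stereoFactor_mul (a := a) (b := b) (z := z)
  simp only [Target.form, Target.curv, Fin.sum_univ_two, pd_apply hd]
  simp only [conformalMap, Matrix.cons_val]
  simp (disch := fun_prop) only [pd_sub, pd_mul, pd_const, pd_stereoFactor, pd_zero_mulRe,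
    pd_one_mulRe, pd_zero_mulIm, pd_one_mulIm]
  generalize mulRe a b z = u at *
  generalize mulIm a b z = v at *
  generalize stereoFactor a b z = R at *
  have h4 : 1 + u ^ 2 + v ^ 2 ≠ 0 := by positivity
  obtain rfl : R = (1 + u ^ 2 + v ^ 2)⁻¹ := eq_inv_of_mul_eq_one_left h
  rcases (by simpa using hε : ε = 1 ∨ ε = -1) with rfl | rfl <;> field_simp <;> ring

/-- The potential term is compensated, up to a divergence, by passing to the holomorphic frame
of the tangent planes along `conformalMap`. -/
lemma conformal_frame_identity (hε : ε ^ 2 = 1) {A B : Plane → ℝ} (hA : ContDiff ℝ ∞ A)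
    (hB : ContDiff ℝ ∞ B) {φ : Plane → Fin 3 → ℝ} (hφd : DifferentiableAt ℝ φ z)
    (hφ : ∀ z, φ z = fun i => stereoFactor a b z ^ 2 *
      (A z * ![1 + mulIm a b z ^ 2 - mulRe a b z ^ 2, -2 * mulRe a b z * mulIm a b z,
          -2 * ε * mulRe a b z] i
        + B z * ![-2 * mulRe a b z * mulIm a b z, 1 + mulRe a b z ^ 2 - mulIm a b z ^ 2,
          -2 * ε * mulIm a b z] i)) :
    ∑ j, Target.sphere.form (pd j φ z) (pd j φ z)
        - 8 * (a ^ 2 + b ^ 2) * stereoFactor a b z ^ 2 * Target.sphere.form (φ z) (φ z)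
      = stereoFactor a b z ^ 2 * ((pd 0 A z - pd 1 B z) ^ 2 + (pd 0 B z + pd 1 A z) ^ 2)
        + pd 0 (fun w => -2 * (A w ^ 2 + B w ^ 2) * stereoFactor a b w ^ 2 * stereoFactor a b w
            * (a * mulRe a b w + b * mulIm a b w)
          + stereoFactor a b w ^ 2 * (A w * pd 1 B w - B w * pd 1 A w)) z
        + pd 1 (fun w => -2 * (A w ^ 2 + B w ^ 2) * stereoFactor a b w ^ 2 * stereoFactor a b w
            * (-b * mulRe a b w + a * mulIm a b w)
          - stereoFactor a b w ^ 2 * (A w * pd 0 B w - B w * pd 0 A w)) z := by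
  have h1 : DifferentiableAt ℝ (mulRe a b) z := contDiff_mulRe.differentiable (by simp) z
  have h2 : DifferentiableAt ℝ (mulIm a b) z := contDiff_mulIm.differentiable (by simp) z
  have h3 : DifferentiableAt ℝ (stereoFactor a b) z :=
    contDiff_stereoFactor.differentiable (by simp) z
  have hAd : DifferentiableAt ℝ A z := hA.differentiable (by simp) z
  have hBd : DifferentiableAt ℝ B z := hB.differentiable (by simp) z
  have hpA : ∀ j, DifferentiableAt ℝ (pd j A) z := fun j =>
    (contDiff_pd hA).differentiable (by simp) z
  have hpB : ∀ j, DifferentiableAt ℝ (pd j B) z := fun j =>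
    (contDiff_pd hB).differentiable (by simp) z
  have := hpA 0; have := hpA 1; have := hpB 0; have := hpB 1
  simp only [Target.form, Target.curv, Fin.sum_univ_two, pd_apply hφd]
  simp only [hφ, Matrix.cons_val]
  -- Only mixed second derivatives of `A` and `B` occur; `pd_comm` puts them in one order so that
  -- they cancel. What remains is a rational identity in values and first derivatives.
  simp (disch := fun_prop) only [pd_add, pd_sub, pd_mul, pd_const, pd_pow_two, pd_stereoFactor,
    pd_zero_mulRe, pd_one_mulRe, pd_zero_mulIm, pd_one_mulIm,
    pd_comm hA.contDiffAt 1 0, pd_comm hB.contDiffAt 1 0]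
  have hR := stereoFactor_mul (a := a) (b := b) (z := z)
  generalize pd 0 (pd 1 A) z = A01
  generalize pd 0 (pd 1 B) z = B01
  generalize pd 0 A z = A0
  generalize pd 1 A z = A1
  generalize pd 0 B z = B0
  generalize pd 1 B z = B1
  generalize A z = α
  generalize B z = β
  generalize mulRe a b z = u at *
  generalize mulIm a b z = v at *
  generalize stereoFactor a b z = R at *
  have h4 : 1 + u ^ 2 + v ^ 2 ≠ 0 := by positivity
  obtain rfl : R = (1 + u ^ 2 + v ^ 2)⁻¹ := eq_inv_of_mul_eq_one_left hR
  rcases (by simpa using hε : ε = 1 ∨ ε = -1) with rfl | rfl <;> field_simp <;> ring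

end

section

variable {a b ε : ℝ} {z : Plane}

/-- The resolution of the identity by the conformal frame and the normal vector. -/
lemma conformal_frame_resolution (hε : ε ^ 2 = 1) (v : Fin 3 → ℝ) (i : Fin 3) :
    v i = stereoFactor a b z ^ 2 *
      ((v 0 * (1 + mulIm a b z ^ 2 - mulRe a b z ^ 2) + v 1 * (-2 * mulRe a b z * mulIm a b z)
          + v 2 * (-2 * ε * mulRe a b z))
        * ![1 + mulIm a b z ^ 2 - mulRe a b z ^ 2, -2 * mulRe a b z * mulIm a b z,
          -2 * ε * mulRe a b z] i
        + (v 0 * (-2 * mulRe a b z * mulIm a b z) + v 1 * (1 + mulRe a b z ^ 2 - mulIm a b z ^ 2)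
          + v 2 * (-2 * ε * mulIm a b z))
        * ![-2 * mulRe a b z * mulIm a b z, 1 + mulRe a b z ^ 2 - mulIm a b z ^ 2,
          -2 * ε * mulIm a b z] i)
      + Target.sphere.form v (conformalMap a b ε z) * conformalMap a b ε z i := by
  have h := stereoFactor_mul (a := a) (b := b) (z := z)
  simp only [Target.form, Target.curv, conformalMap, Matrix.cons_val]
  generalize mulRe a b z = x at *
  generalize mulIm a b z = y at *
  generalize stereoFactor a b z = R at *
  have h4 : 1 + x ^ 2 + y ^ 2 ≠ 0 := by positivity
  obtain rfl : R = (1 + x ^ 2 + y ^ 2)⁻¹ := eq_inv_of_mul_eq_one_left h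
  rcases (by simpa using hε : ε = 1 ∨ ε = -1) with rfl | rfl <;> fin_cases i <;>
    simp only [Fin.zero_eta, Fin.mk_one, Fin.reduceFinMk, Matrix.cons_val] <;> field_simp <;> ring

/-- The two frame vectors are orthogonal, each of squared length R⁻². They are the coordinate
derivatives of the inverse stereographic projection divided by 2R². -/
lemma form_conformal_frame (hε : ε ^ 2 = 1) (α β : ℝ) {v : Fin 3 → ℝ}
    (hv : v = fun i => stereoFactor a b z ^ 2 *
      (α * ![1 + mulIm a b z ^ 2 - mulRe a b z ^ 2, -2 * mulRe a b z * mulIm a b z,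
          -2 * ε * mulRe a b z] i
        + β * ![-2 * mulRe a b z * mulIm a b z, 1 + mulRe a b z ^ 2 - mulIm a b z ^ 2,
          -2 * ε * mulIm a b z] i)) :
    Target.sphere.form v v = stereoFactor a b z ^ 2 * (α ^ 2 + β ^ 2) := by
  have h := stereoFactor_mul (a := a) (b := b) (z := z)
  subst hv
  simp only [Target.form, Target.curv, Matrix.cons_val]
  generalize mulRe a b z = x at *
  generalize mulIm a b z = y at *
  generalize stereoFactor a b z = R at *
  have h4 : 1 + x ^ 2 + y ^ 2 ≠ 0 := by positivity
  obtain rfl : R = (1 + x ^ 2 + y ^ 2)⁻¹ := eq_inv_of_mul_eq_one_left h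
  rcases (by simpa using hε : ε = 1 ∨ ε = -1) with rfl | rfl <;> field_simp <;> ring

end

/-- The scalar Hardy inequality on the disk, up to a divergence. -/
lemma hardy_scalar {A : Plane → ℝ} {z : Plane} (hz : z ∈ disk) (hA : DifferentiableAt ℝ A z) :
    A z ^ 2 / (1 - (z 0 ^ 2 + z 1 ^ 2)) ^ 2
        + ∑ j, pd j (fun w => -(hardyField j w * (fun w => A w ^ 2) w)) z
      ≤ ∑ j, pd j A z ^ 2 := by
  have h := hardy_pointwise (G := fun w => A w ^ 2) hz (by fun_prop) (sq_nonneg _)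
  refine h.trans (Finset.sum_le_sum fun j _ => ?_)
  rw [pd_pow_two hA]
  nlinarith [sq_nonneg (pd j A z + hardyField j z * A z)]

/-- Conformal degree one maps to the sphere are weakly linearly stable. -/
theorem weaklyLinearlyStable_of_eq_conformalMap {Q : Plane → Fin 3 → ℝ} {a b ε : ℝ}
    (hε : ε ^ 2 = 1) (hQ : ∀ z ∈ disk, Q z = conformalMap a b ε z) :
    WeaklyLinearlyStable Target.sphere Q := by
  have hQs : IsSmoothMap Target.sphere Q := by
    refine ⟨contDiff_conformalMap.contDiffOn.congr hQ, fun z hz => ?_⟩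
    rw [hQ z hz]
    exact form_conformalMap hε
  have hm : 0 ≤ a ^ 2 + b ^ 2 := by positivity
  set k : ℝ := (1 + (a ^ 2 + b ^ 2))⁻¹ with hk
  have hk0 : 0 < k := by positivity
  -- The factor `k` bounds `stereoFactor` from below on the disk, and 1/2 is the Hardy constant.
  refine weaklyLinearlyStable_of_divergence hQs (ρ := k / 2) (by positivity) fun φ hφ => ?_
  have hφs := contDiff_pi.1 hφ.smooth
  have hφ0 := hφs 0
  have hφ1 := hφs 1
  have hφ2 := hφs 2
  have hu := contDiff_mulRe (a := a) (b := b)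
  have hv := contDiff_mulIm (a := a) (b := b)
  have hR := contDiff_stereoFactor (a := a) (b := b)
  -- `A` and `B` are the inner products of φ with the frame vectors; A + iB is twice the component
  -- of φ in the stereographic coordinate.
  set A : Plane → ℝ := fun z => φ z 0 * (1 + mulIm a b z ^ 2 - mulRe a b z ^ 2)
    + φ z 1 * (-2 * mulRe a b z * mulIm a b z) + φ z 2 * (-2 * ε * mulRe a b z) with hA
  set B : Plane → ℝ := fun z => φ z 0 * (-2 * mulRe a b z * mulIm a b z)
    + φ z 1 * (1 + mulRe a b z ^ 2 - mulIm a b z ^ 2) + φ z 2 * (-2 * ε * mulIm a b z) with hB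
  have hAs : ContDiff ℝ ∞ A := by fun_prop
  have hBs : ContDiff ℝ ∞ B := by fun_prop
  have hφz : ∀ z ∉ disk, φ z = 0 := fun z hz =>
    image_eq_zero_of_notMem_tsupport fun h => hz (hφ.support_subset h)
  have hφeq : ∀ z, φ z = fun i => stereoFactor a b z ^ 2 *
      (A z * ![1 + mulIm a b z ^ 2 - mulRe a b z ^ 2, -2 * mulRe a b z * mulIm a b z,
          -2 * ε * mulRe a b z] i
        + B z * ![-2 * mulRe a b z * mulIm a b z, 1 + mulRe a b z ^ 2 - mulIm a b z ^ 2,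
          -2 * ε * mulIm a b z] i) := by
    intro z
    have ht : Target.sphere.form (φ z) (conformalMap a b ε z) = 0 := by
      by_cases hz : z ∈ disk
      · rw [← hQ z hz]
        exact hφ.tangent z hz
      · simp [hφz z hz, Target.form]
    ext i
    have := conformal_frame_resolution (a := a) (b := b) (z := z) hε (φ z) i
    rw [ht, zero_mul, add_zero] at this
    exact this
  set W : Fin 2 → Plane → ℝ := ![
    fun w => -2 * (A w ^ 2 + B w ^ 2) * stereoFactor a b w ^ 2 * stereoFactor a b w
        * (a * mulRe a b w + b * mulIm a b w)
      + stereoFactor a b w ^ 2 * (A w * pd 1 B w - B w * pd 1 A w),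
    fun w => -2 * (A w ^ 2 + B w ^ 2) * stereoFactor a b w ^ 2 * stereoFactor a b w
        * (-b * mulRe a b w + a * mulIm a b w)
      - stereoFactor a b w ^ 2 * (A w * pd 0 B w - B w * pd 0 A w)] with hW
  -- Its divergence is the null Lagrangian by which |2∂̄(A+iB)|² exceeds |∇A|² + |∇B|².
  set Y : Fin 2 → Plane → ℝ := ![fun w => -2 * (A w * pd 1 B w), fun w => 2 * (A w * pd 0 B w)]
    with hY
  set X : Fin 2 → Plane → ℝ := fun j w => -(hardyField j w * (fun w => A w ^ 2) w)
    + -(hardyField j w * (fun w => B w ^ 2) w) with hX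
  have hpA : ∀ j, ContDiff ℝ ∞ (pd j A) := fun j => contDiff_pd hAs
  have hpB : ∀ j, ContDiff ℝ ∞ (pd j B) := fun j => contDiff_pd hBs
  have hpA0 := hpA 0
  have hpA1 := hpA 1
  have hpB0 := hpB 0
  have hpB1 := hpB 1
  have hWs : ∀ j, ContDiff ℝ ∞ (W j) := by
    intro j
    fin_cases j <;> simp only [W, Fin.zero_eta, Fin.mk_one, Matrix.cons_val] <;> fun_prop
  have hYs : ∀ j, ContDiff ℝ ∞ (Y j) := by
    intro j
    fin_cases j <;> simp only [Y, Fin.zero_eta, Fin.mk_one, Matrix.cons_val] <;> fun_prop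
  have hXA : ∀ j, ∀ z ∈ disk,
      ContDiffAt ℝ ∞ (fun w => -(hardyField j w * (fun w => A w ^ 2) w)) z := fun j z hz =>
    ((contDiffAt_hardyField hz).mul (hAs.pow 2).contDiffAt).neg
  have hXB : ∀ j, ∀ z ∈ disk,
      ContDiffAt ℝ ∞ (fun w => -(hardyField j w * (fun w => B w ^ 2) w)) z := fun j z hz =>
    ((contDiffAt_hardyField hz).mul (hBs.pow 2).contDiffAt).neg
  refine ⟨fun j w => W j w + k ^ 2 * (Y j w + X j w), fun j z hz => ?_, fun j z hz => ?_,
    fun z hz => ?_⟩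
  · exact ((hWs j).contDiffAt.add (contDiffAt_const.mul ((hYs j).contDiffAt.add
      ((hXA j z hz).add (hXB j z hz))))).contDiffWithinAt
  · have h0 : φ z = 0 := image_eq_zero_of_notMem_tsupport hz
    have hA0 : A z = 0 := by simp [hA, h0]
    have hB0 : B z = 0 := by simp [hB, h0]
    fin_cases j <;> simp [W, Y, X, hA0, hB0]
  · have hAd : DifferentiableAt ℝ A z := hAs.differentiable (by simp) z
    have hBd : DifferentiableAt ℝ B z := hBs.differentiable (by simp) z
    have hid := conformal_frame_identity hε hAs hBs (hφ.smooth.differentiable (by simp) z) hφeq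
    have hpdZ : ∀ j, pd j (fun w => W j w + k ^ 2 * (Y j w + X j w)) z
        = pd j (W j) z + k ^ 2 * (pd j (Y j) z
          + (pd j (fun w => -(hardyField j w * (fun w => A w ^ 2) w)) z
            + pd j (fun w => -(hardyField j w * (fun w => B w ^ 2) w)) z)) := by
      intro j
      have e1 : DifferentiableAt ℝ (W j) z := (hWs j).differentiable (by simp) z
      have e2 : DifferentiableAt ℝ (Y j) z := (hYs j).differentiable (by simp) z
      have e3 := (hXA j z hz).differentiableAt (by simp)
      have e4 := (hXB j z hz).differentiableAt (by simp)
      have e5 : DifferentiableAt ℝ (X j) z := e3.add e4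
      rw [pd_add e1 ((e2.fun_add e5).const_mul _), pd_mul (differentiableAt_const _) (e2.fun_add e5),
        pd_const, pd_add e2 e5, hX, pd_add e3 e4]
      ring
    have hQe : ∀ j, pd j Q z = pd j (conformalMap a b ε) z := fun j => by
      apply pd_congr
      filter_upwards [isOpen_disk.mem_nhds hz] with w hw using hQ w hw
    have hY01 : pd 0 (Y 0) z + pd 1 (Y 1) z
        = 2 * (pd 0 B z * pd 1 A z - pd 0 A z * pd 1 B z) := by
      have := (hpA 0).differentiable (by simp) z
      have := (hpB 0).differentiable (by simp) z
      have := (hpB 1).differentiable (by simp) z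
      simp only [Y, Matrix.cons_val]
      simp (disch := fun_prop) only [pd_mul, pd_const, pd_comm hBs.contDiffAt 1 0]
      ring
    have hhA := hardy_scalar hz hAd
    have hhB := hardy_scalar hz hBd
    have hW0 : W 0 = fun w => -2 * (A w ^ 2 + B w ^ 2) * stereoFactor a b w ^ 2
        * stereoFactor a b w * (a * mulRe a b w + b * mulIm a b w)
      + stereoFactor a b w ^ 2 * (A w * pd 1 B w - B w * pd 1 A w) := rfl
    have hW1 : W 1 = fun w => -2 * (A w ^ 2 + B w ^ 2) * stereoFactor a b w ^ 2
        * stereoFactor a b w * (-b * mulRe a b w + a * mulIm a b w)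
      - stereoFactor a b w ^ 2 * (A w * pd 0 B w - B w * pd 0 A w) := rfl
    rw [← hW0, ← hW1] at hid
    have hen := energy_conformalMap (a := a) (b := b) (z := z) hε
    have hnorm := form_conformal_frame hε (A z) (B z) (hφeq z)
    have hRk : k ^ 2 ≤ stereoFactor a b z ^ 2 := pow_le_pow_left₀ hk0.le (le_stereoFactor hz) 2
    have hR1 : stereoFactor a b z ^ 2 ≤ 1 := pow_le_one₀ stereoFactor_pos.le stereoFactor_le_one
    have hmass : (k / 2) ^ 2 * (Target.sphere.form (φ z) (φ z) * volDensity z)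
        ≤ k ^ 2 * (A z ^ 2 / (1 - (z 0 ^ 2 + z 1 ^ 2)) ^ 2
          + B z ^ 2 / (1 - (z 0 ^ 2 + z 1 ^ 2)) ^ 2) := by
      have : (k / 2) ^ 2 * (Target.sphere.form (φ z) (φ z) * volDensity z)
          = k ^ 2 * (stereoFactor a b z ^ 2 * (A z ^ 2 / (1 - (z 0 ^ 2 + z 1 ^ 2)) ^ 2
          + B z ^ 2 / (1 - (z 0 ^ 2 + z 1 ^ 2)) ^ 2)) := by
        rw [hnorm, volDensity_eq]
        ring
      rw [this]
      exact mul_le_mul_of_nonneg_left (mul_le_of_le_one_left (by positivity) hR1) (by positivity)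
    -- The weight is lowered to a constant before expanding the square: with a variable weight the
    -- cross term would not be a divergence.
    have hS : k ^ 2 * ((pd 0 A z - pd 1 B z) ^ 2 + (pd 0 B z + pd 1 A z) ^ 2)
        ≤ stereoFactor a b z ^ 2 * ((pd 0 A z - pd 1 B z) ^ 2 + (pd 0 B z + pd 1 A z) ^ 2) :=
      mul_le_mul_of_nonneg_right hRk (by positivity)
    have hsum := mul_le_mul_of_nonneg_left (add_le_add hhA hhB) (sq_nonneg k)
    simp only [hQe, hen, Target.curv, one_mul]
    rw [hid]
    simp only [Fin.sum_univ_two] at hsum ⊢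
    rw [hpdZ, hpdZ]
    have hYk : k ^ 2 * (pd 0 (Y 0) z + pd 1 (Y 1) z)
        = k ^ 2 * (2 * (pd 0 B z * pd 1 A z - pd 0 A z * pd 1 B z)) := by rw [hY01]
    linarith

/-! ### Classification of equivariant harmonic maps to the sphere -/

/-- A solution of `t w' = w` on `[0, 1]` is linear. -/
lemma eq_deriv_zero_of_mul_deriv_eq {w w' : ℝ → ℝ}
    (hw : ∀ t ∈ Set.Icc (0 : ℝ) 1, HasDerivAt w (w' t) t)
    (h : ∀ t ∈ Set.Icc (0 : ℝ) 1, t * w' t = w t) : w 1 = w' 0 := by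
  have hlin : ∀ s ∈ Set.Icc (0 : ℝ) 1, w s = s * w 1 := by
    intro s hs
    rcases hs.1.eq_or_lt with rfl | hs0
    · rw [zero_mul, ← h 0 hs, zero_mul]
    · have hsub : ∀ t ∈ Set.Icc s 1, t ∈ Set.Icc (0 : ℝ) 1 ∧ t ≠ 0 := fun t ht =>
        ⟨⟨hs0.le.trans ht.1, ht.2⟩, (hs0.trans_le ht.1).ne'⟩
      have hd : ∀ t ∈ Set.Icc s 1, HasDerivAt (fun t => w t / t) 0 t := by
        intro t ht
        obtain ⟨ht1, ht0⟩ := hsub t ht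
        have := (hw t ht1).fun_div (hasDerivAt_id' t) ht0
        refine this.congr_deriv ?_
        rw [← h t ht1]
        field_simp
        ring
      have := constant_of_has_deriv_right_zero (f := fun t => w t / t) (a := s) (b := 1)
        (fun t ht => (hd t ht).continuousAt.continuousWithinAt)
        (fun t ht => (hd t ⟨ht.1, ht.2.le⟩).hasDerivWithinAt) 1 ⟨hs.2, le_rfl⟩
      field_simp at this
      linarith
  have h0 : (0 : ℝ) ∈ Set.Icc (0 : ℝ) 1 := by simp
  have h1 : HasDerivWithinAt w (w 1) (Set.Icc 0 1) 0 := by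
    have : HasDerivWithinAt (fun s => s * w 1) (w 1) (Set.Icc (0 : ℝ) 1) 0 := by
      simpa using ((hasDerivAt_id' (0 : ℝ)).mul_const (w 1)).hasDerivWithinAt
    exact this.congr hlin (hlin 0 h0)
  exact (uniqueDiffOn_Icc zero_lt_one 0 h0).eq_deriv _ h1 (hw 0 h0).hasDerivWithinAt

/-- The restriction of an equivariant harmonic map to a ray is determined by its velocity at the
origin. -/
lemma ray_solution {U : Set ℝ} (hU : IsOpen U) (hIU : Set.Icc (0 : ℝ) 1 ⊆ U)
    {q p d : Fin 3 → ℝ → ℝ} {c : ℝ → ℝ} {ε : ℝ}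
    (hq : ∀ i, ∀ t ∈ U, HasDerivAt (q i) (p i t) t)
    (hp : ∀ i, ∀ t ∈ U, HasDerivAt (p i) (d i t) t)
    (hn : ∀ t ∈ U, q 0 t ^ 2 + q 1 t ^ 2 + q 2 t ^ 2 = 1)
    (e0 : ∀ t ∈ U, t ^ 2 * d 0 t + t * p 0 t = c t * q 0 t + q 0 t)
    (e1 : ∀ t ∈ U, t ^ 2 * d 1 t + t * p 1 t = c t * q 1 t + q 1 t)
    (e2 : ∀ t ∈ U, t ^ 2 * d 2 t + t * p 2 t = c t * q 2 t)
    (hq0 : q 0 0 = 0) (hq1 : q 1 0 = 0) (hq2 : q 2 0 = ε) :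
    q 0 1 = (1 + ε * q 2 1) * (p 0 0 / 2) ∧ q 1 1 = (1 + ε * q 2 1) * (p 1 0 / 2) ∧
      (1 + ε * q 2 1) * (1 + (p 0 0 / 2) ^ 2 + (p 1 0 / 2) ^ 2) = 2 := by
  have hI0 : (0 : ℝ) ∈ Set.Icc (0 : ℝ) 1 := by simp
  have hI1 : (1 : ℝ) ∈ Set.Icc (0 : ℝ) 1 := by simp
  have hε : ε ^ 2 = 1 := by
    have := hn 0 (hIU hI0)
    rw [hq0, hq1, hq2] at this
    linarith
  have hpq : ∀ t ∈ U, p 0 t * q 0 t + p 1 t * q 1 t + p 2 t * q 2 t = 0 := by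
    intro t ht
    have h1 := (((hq 0 t ht).fun_pow 2).fun_add ((hq 1 t ht).fun_pow 2)).fun_add
      ((hq 2 t ht).fun_pow 2)
    have h2 : HasDerivAt (fun t => q 0 t ^ 2 + q 1 t ^ 2 + q 2 t ^ 2) 0 t :=
      (hasDerivAt_const t (1 : ℝ)).congr_of_eventuallyEq
        (by filter_upwards [hU.mem_nhds ht] with s hs using hn s hs)
    have := h1.unique h2
    norm_num at this
    linarith
  have hdq : ∀ t ∈ U, d 0 t * q 0 t + d 1 t * q 1 t + d 2 t * q 2 t
      = -(p 0 t ^ 2 + p 1 t ^ 2 + p 2 t ^ 2) := by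
    intro t ht
    have h1 := (((hp 0 t ht).fun_mul (hq 0 t ht)).fun_add
      ((hp 1 t ht).fun_mul (hq 1 t ht))).fun_add ((hp 2 t ht).fun_mul (hq 2 t ht))
    have h2 : HasDerivAt (fun t => p 0 t * q 0 t + p 1 t * q 1 t + p 2 t * q 2 t) 0 t :=
      (hasDerivAt_const t (0 : ℝ)).congr_of_eventuallyEq
        (by filter_upwards [hU.mem_nhds ht] with s hs using hpq s hs)
    have := h1.unique h2
    linarith
  have hconst : ∀ f : ℝ → ℝ, (∀ t ∈ Set.Icc (0 : ℝ) 1, HasDerivAt f 0 t) → f 0 = 0 →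
      ∀ t ∈ Set.Icc (0 : ℝ) 1, f t = 0 := by
    intro f hf h0 t ht
    rw [← h0]
    exact constant_of_has_deriv_right_zero (fun t ht => (hf t ht).continuousAt.continuousWithinAt)
      (fun t ht => (hf t ⟨ht.1, ht.2.le⟩).hasDerivWithinAt) t ht
  -- the radial and angular energies agree
  have hF : ∀ t ∈ Set.Icc (0 : ℝ) 1,
      t ^ 2 * (p 0 t ^ 2 + p 1 t ^ 2 + p 2 t ^ 2) - (q 0 t ^ 2 + q 1 t ^ 2) = 0 := by
    refine hconst _ (fun t ht => ?_) (by simp [hq0, hq1])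
    have hu := hIU ht
    have := (((hasDerivAt_id' t).fun_pow 2).fun_mul ((((hp 0 t hu).fun_pow 2).fun_add
      ((hp 1 t hu).fun_pow 2)).fun_add ((hp 2 t hu).fun_pow 2))).fun_sub
      (((hq 0 t hu).fun_pow 2).fun_add ((hq 1 t hu).fun_pow 2))
    refine this.congr_deriv ?_
    norm_num
    linear_combination 2 * p 0 t * e0 t hu + 2 * p 1 t * e1 t hu + 2 * p 2 t * e2 t hu
      + 2 * c t * hpq t hu
  -- the angular momentum vanishes
  have hG : ∀ t ∈ Set.Icc (0 : ℝ) 1, t * (p 1 t * q 0 t - p 0 t * q 1 t) = 0 := by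
    refine hconst _ (fun t ht => ?_) (by simp)
    have hu := hIU ht
    have := (hasDerivAt_id' t).fun_mul (((hp 1 t hu).fun_mul (hq 0 t hu)).fun_sub
      ((hp 0 t hu).fun_mul (hq 1 t hu)))
    refine this.congr_deriv ?_
    rcases ht.1.eq_or_lt with rfl | ht0
    · simp [hq0, hq1]
    · apply mul_left_cancel₀ ht0.ne'
      linear_combination q 0 t * e1 t hu - q 1 t * e0 t hu
  -- Pairing the equation with `q` identifies the Lagrange multiplier `c`, by `hdq` and `hF`.
  have hc : ∀ t ∈ Set.Icc (0 : ℝ) 1, c t = -2 * (1 - q 2 t ^ 2) := by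
    intro t ht
    have hu := hIU ht
    linear_combination -q 0 t * e0 t hu - q 1 t * e1 t hu - q 2 t * e2 t hu + t ^ 2 * hdq t hu
      + t * hpq t hu - hF t ht - (c t + 2) * hn t hu
  -- a bound for the velocity
  obtain ⟨C, hC⟩ : ∃ C : ℝ, ∀ t ∈ Set.Icc (0 : ℝ) 1, ‖p 2 t‖ ≤ C :=
    isCompact_Icc.exists_bound_of_continuousOn
      fun t ht => (hp 2 t (hIU ht)).continuousAt.continuousWithinAt
  have hε1 : |ε| = 1 := by
    rcases (by simpa using hε : ε = 1 ∨ ε = -1) with rfl | rfl <;> simp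
  have hx : ∀ t ∈ Set.Icc (0 : ℝ) 1, |1 - ε * q 2 t| ≤ C * t := by
    intro t ht
    have := norm_image_sub_le_of_norm_deriv_le_segment' (f := fun t => ε * q 2 t)
      (f' := fun t => ε * p 2 t) (a := 0) (b := 1) (C := C)
      (fun s hs => ((hq 2 s (hIU hs)).const_mul ε).hasDerivWithinAt)
      (fun s hs => by simpa [hε1] using hC s ⟨hs.1, hs.2.le⟩) t ht
    rw [hq2, Real.norm_eq_abs, abs_sub_comm, sub_zero] at this
    rwa [← hε, pow_two]
  -- the first order equation
  have hg : ∀ t ∈ Set.Icc (0 : ℝ) 1, t ^ 2 * (t * p 2 t + ε * (1 - q 2 t ^ 2)) = 0 := by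
    -- The defect y = tq₂' + ε(1 - q₂²) solves ty' = -2εq₂y, singular at 0 with exponent -2. The
    -- factor t² compensates: the coefficient becomes 1 - εq₂ = O(t), and Gronwall applies from t =
    -- 0.
    have hder : ∀ t ∈ Set.Icc (0 : ℝ) 1,
        HasDerivAt (fun t => t ^ 2 * (t * p 2 t + ε * (1 - q 2 t ^ 2)))
        (2 * t * (1 - ε * q 2 t) * (t * p 2 t + ε * (1 - q 2 t ^ 2))) t := by
      intro t ht
      have hu := hIU ht
      have := ((hasDerivAt_id' t).fun_pow 2).fun_mul (((hasDerivAt_id' t).fun_mul (hp 2 t hu)).fun_add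
        ((((hq 2 t hu).fun_pow 2).const_sub 1).const_mul ε))
      refine this.congr_deriv ?_
      norm_num
      linear_combination t * e2 t hu + t * q 2 t * hc t ht + 2 * t * q 2 t * (1 - q 2 t ^ 2) * hε
    refine eq_zero_of_abs_deriv_le_mul_abs_self_of_eq_zero_right (K := 2 * C)
      (fun t ht => (hder t ht).continuousAt.continuousWithinAt)
      (fun t ht => (hder t ⟨ht.1, ht.2.le⟩).hasDerivWithinAt) (by simp) fun t ht => ?_
    have := hx t ⟨ht.1, ht.2.le⟩
    simp only [norm_mul, Real.norm_eq_abs, abs_pow, abs_of_nonneg ht.1, abs_two]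
    have h2 := mul_le_mul_of_nonneg_right this
      (mul_nonneg ht.1 (abs_nonneg (t * p 2 t + ε * (1 - q 2 t ^ 2))))
    nlinarith
  have hh : ∀ t ∈ Set.Icc (0 : ℝ) 1, t * p 2 t = -(ε * (1 - q 2 t ^ 2)) := by
    intro t ht
    rcases ht.1.eq_or_lt with rfl | ht0
    · rw [hq2, hε]
      simp
    · have := (mul_eq_zero.1 (hg t ht)).resolve_left (by positivity)
      linarith
  -- the image avoids the antipode of the image of the origin
  have ha : ∀ t ∈ Set.Icc (0 : ℝ) 1, 1 + ε * q 2 t ≠ 0 := by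
    intro t₀ ht₀ h0
    have hmem : ∀ τ ∈ Set.Icc 0 t₀, t₀ - τ ∈ Set.Icc (0 : ℝ) 1 := fun τ hτ =>
      ⟨by linarith [hτ.2], by linarith [hτ.1, ht₀.2]⟩
    have hder : ∀ τ ∈ Set.Icc 0 t₀, HasDerivAt (fun τ => 1 + ε * q 2 (t₀ - τ))
        (-(ε * p 2 (t₀ - τ))) τ := by
      intro τ hτ
      have h1 := (hq 2 (t₀ - τ) (hIU (hmem τ hτ))).comp τ ((hasDerivAt_id' τ).const_sub t₀)
      have h2 := (h1.const_mul ε).const_add 1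
      refine h2.congr_deriv ?_
      ring
    -- Gronwall run backwards from t₀: a zero would propagate to t = 0, where the value is 1 + ε² =
    -- 2.
    have := eq_zero_of_abs_deriv_le_mul_abs_self_of_eq_zero_right (K := C)
      (f := fun τ => 1 + ε * q 2 (t₀ - τ))
      (fun τ hτ => (hder τ hτ).continuousAt.continuousWithinAt)
      (fun τ hτ => (hder τ ⟨hτ.1, hτ.2.le⟩).hasDerivWithinAt) (by simpa using h0)
      (fun τ hτ => by
        have ht := hmem τ ⟨hτ.1, hτ.2.le⟩
        have hpos : 0 < t₀ - τ := by linarith [hτ.2]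
        generalize t₀ - τ = t at *
        rw [norm_neg, norm_mul, Real.norm_eq_abs, hε1, one_mul, Real.norm_eq_abs,
          Real.norm_eq_abs]
        have h3 : t * p 2 t = -ε * ((1 + ε * q 2 t) * (1 - ε * q 2 t)) := by
          rw [hh t ht]
          linear_combination -ε * q 2 t ^ 2 * hε
        have h4 : t * |p 2 t| = |1 + ε * q 2 t| * |1 - ε * q 2 t| := by
          rw [← abs_of_pos hpos, ← abs_mul, abs_of_pos hpos, h3, abs_mul, abs_neg, hε1, one_mul,
            abs_mul]
        have h5 := mul_le_mul_of_nonneg_left (hx t ht) (abs_nonneg (1 + ε * q 2 t))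
        refine le_of_mul_le_mul_left ?_ hpos
        linarith) t₀ ⟨ht₀.1, le_rfl⟩
    simp only [sub_self, hq2] at this
    nlinarith
  -- the horizontal velocity
  have hv : ∀ t ∈ Set.Icc (0 : ℝ) 1, t * p 0 t = ε * q 2 t * q 0 t ∧
      t * p 1 t = ε * q 2 t * q 1 t := by
    intro t ht
    have hu := hIU ht
    have h1 : t * p 0 t * q 0 t + t * p 1 t * q 1 t = ε * (q 0 t ^ 2 + q 1 t ^ 2) * q 2 t := by
      linear_combination t * hpq t hu - q 2 t * hh t ht - ε * q 2 t * hn t hu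
    have h2 := hG t ht
    by_cases hk : q 0 t ^ 2 + q 1 t ^ 2 = 0
    -- On the axis `h1` and `h2` carry no information; there `hF` forces tq' = 0.
    · have hz0 : q 0 t = 0 := by nlinarith [sq_nonneg (q 0 t), sq_nonneg (q 1 t)]
      have hz1 : q 1 t = 0 := by nlinarith [sq_nonneg (q 0 t), sq_nonneg (q 1 t)]
      have hF' := hF t ht
      rw [hk] at hF'
      have hs : (t * p 0 t) ^ 2 + (t * p 1 t) ^ 2 + (t * p 2 t) ^ 2 = 0 := by linarith
      rw [hz0, hz1, mul_zero]
      constructor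
      · nlinarith [sq_nonneg (t * p 0 t), sq_nonneg (t * p 1 t), sq_nonneg (t * p 2 t)]
      · nlinarith [sq_nonneg (t * p 0 t), sq_nonneg (t * p 1 t), sq_nonneg (t * p 2 t)]
    · constructor
      · apply mul_right_cancel₀ hk
        linear_combination q 0 t * h1 - q 1 t * h2
      · apply mul_right_cancel₀ hk
        linear_combination q 1 t * h1 + q 0 t * h2
  -- the stereographic coordinates are linear
  have hw : ∀ i : Fin 3, q i 0 = 0 →
      (∀ t ∈ Set.Icc (0 : ℝ) 1, t * p i t = ε * q 2 t * q i t) →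
      q i 1 = (1 + ε * q 2 1) * (p i 0 / 2) := by
    intro i hi0 hi
    -- The stereographic coordinate w satisfies tw' = w. Its denominator is 2 at the origin, which
    -- gives the slope `p i 0 / 2`.
    have := eq_deriv_zero_of_mul_deriv_eq (w := fun t => q i t / (1 + ε * q 2 t))
      (w' := fun t => (p i t * (1 + ε * q 2 t) - q i t * (ε * p 2 t)) / (1 + ε * q 2 t) ^ 2)
      (fun t ht => (hq i t (hIU ht)).fun_div (((hq 2 t (hIU ht)).const_mul ε).const_add 1)
        (ha t ht))
      (fun t ht => by
        have := ha t ht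
        field_simp
        linear_combination (1 + ε * q 2 t) * hi t ht - ε * q i t * hh t ht
          + q i t * hε)
    simp only [hq2, hi0] at this
    have h1 := ha 1 hI1
    rw [div_eq_iff h1] at this
    rw [this, ← pow_two, hε]
    ring
  have hw0 := hw 0 hq0 fun t ht => (hv t ht).1
  have hw1 := hw 1 hq1 fun t ht => (hv t ht).2
  refine ⟨hw0, hw1, ?_⟩
  apply mul_left_cancel₀ (ha 1 hI1)
  have := hn 1 (hIU hI1)
  rw [hw0, hw1] at this
  linear_combination this + q 2 1 ^ 2 * hε

/-- `rot` as a continuous linear map. -/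
def rotCLM : Plane →L[ℝ] Plane :=
  LinearMap.toContinuousLinearMap
    { toFun := rot
      map_add' := fun x y => by ext i; fin_cases i <;> simp [rot]; ring
      map_smul' := fun c x => by ext i; fin_cases i <;> simp [rot] }

/-- `Target.rot` as a continuous linear map. -/
def Target.rotCLM : (Fin 3 → ℝ) →L[ℝ] (Fin 3 → ℝ) :=
  LinearMap.toContinuousLinearMap
    { toFun := Target.rot
      map_add' := fun x y => by ext i; fin_cases i <;> simp [Target.rot]; ring
      map_smul' := fun c x => by ext i; fin_cases i <;> simp [Target.rot] }

lemma eq_single_add_single (w : Plane) :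
    w = w 0 • EuclideanSpace.single 0 (1 : ℝ) + w 1 • EuclideanSpace.single 1 (1 : ℝ) := by
  ext i
  fin_cases i <;> simp

lemma rot_eq_single_add_single (w : Plane) :
    rot w = (-w 1) • EuclideanSpace.single 0 (1 : ℝ) + w 0 • EuclideanSpace.single 1 (1 : ℝ) := by
  ext i
  fin_cases i <;> simp [rot]

lemma rot_rot (w : Plane) : rot (rot w) = -w := by
  ext i
  fin_cases i <;> simp [rot]

/-! ### Equivariant maps: second derivatives and the reduction to rays. -/

section

variable {N : Target} {Q : Plane → Fin 3 → ℝ} {w : Plane}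

lemma hasFDerivAt_of_isSmoothMap (hQ : IsSmoothMap N Q) (hw : w ∈ disk) :
    HasFDerivAt Q (fderiv ℝ Q w) w :=
  ((hQ.1.contDiffAt (isOpen_disk.mem_nhds hw)).differentiableAt (by simp)).hasFDerivAt

lemma hasFDerivAt_fderiv_of_isSmoothMap (hQ : IsSmoothMap N Q) (hw : w ∈ disk) :
    HasFDerivAt (fderiv ℝ Q) (fderiv ℝ (fderiv ℝ Q) w) w :=
  (((hQ.1.contDiffAt (isOpen_disk.mem_nhds hw)).fderiv_right (m := ∞) (by simp)).differentiableAt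
    (by simp)).hasFDerivAt

/-- The equivariance condition, differentiated. -/
lemma IsEquivariant.deriv (hQ : IsSmoothMap N Q) (he : IsEquivariant Q) (hw : w ∈ disk)
    (v : Plane) : fderiv ℝ (fderiv ℝ Q) w v (rot w) + fderiv ℝ Q w (rot v)
      = Target.rot (fderiv ℝ Q w v) := by
  have h1 : HasFDerivAt (fun w => fderiv ℝ Q w (rotCLM w)) _ w :=
    (hasFDerivAt_fderiv_of_isSmoothMap hQ hw).clm_apply rotCLM.hasFDerivAt
  have h2 : HasFDerivAt (fun w => Target.rotCLM (Q w)) _ w :=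
    Target.rotCLM.hasFDerivAt.comp w (hasFDerivAt_of_isSmoothMap hQ hw)
  have h3 := h2.congr_of_eventuallyEq (f₁ := fun w => fderiv ℝ Q w (rotCLM w))
    (by filter_upwards [isOpen_disk.mem_nhds hw] with y hy using he y hy)
  have h4 := DFunLike.congr_fun (h1.unique h3) v
  simp only [add_apply, ContinuousLinearMap.comp_apply,
    ContinuousLinearMap.flip_apply] at h4
  rw [add_comm]
  exact h4

lemma pd_pd_eq (hQ : IsSmoothMap N Q) (hw : w ∈ disk) (j : Fin 2) :
    pd j (pd j Q) w = fderiv ℝ (fderiv ℝ Q) w (EuclideanSpace.single j 1)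
      (EuclideanSpace.single j 1) := by
  have := ((hasFDerivAt_fderiv_of_isSmoothMap hQ hw).clm_apply
    (hasFDerivAt_const (EuclideanSpace.single j (1 : ℝ)) w)).fderiv
  show fderiv ℝ (fun w => fderiv ℝ Q w (EuclideanSpace.single j 1)) w _ = _
  rw [this]
  simp

lemma hasDerivAt_smul_right (t : ℝ) (z : Plane) : HasDerivAt (fun t : ℝ => t • z) z t := by
  simpa using (hasDerivAt_id' t).smul_const z

lemma hasDerivAt_fderiv_ray (hQ : IsSmoothMap N Q) {t : ℝ} {z : Plane} (ht : t • z ∈ disk) :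
    HasDerivAt (fun t : ℝ => fderiv ℝ Q (t • z) z) (fderiv ℝ (fderiv ℝ Q) (t • z) z z) t := by
  have h1 := (hasFDerivAt_fderiv_of_isSmoothMap hQ ht).clm_apply (hasFDerivAt_const z (t • z))
  refine (h1.comp_hasDerivAt t (hasDerivAt_smul_right t z)).congr_deriv ?_
  simp

/-- The harmonic map equation of an equivariant map, as an equation along the rays. -/
lemma radial_equation (hQ : IsSmoothMap N Q) (he : IsEquivariant Q) (hh : IsHarmonic N Q)
    (hw : w ∈ disk) : ∃ c : ℝ, fderiv ℝ (fderiv ℝ Q) w w w + fderiv ℝ Q w w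
      = c • Q w - Target.rot (Target.rot (Q w)) := by
  -- Differentiating equivariance along the rotation field expresses D²Q(Ω, Ω) through DQ(w) and the
  -- target rotation applied twice.
  have h1 := he.deriv hQ hw (rot w)
  rw [he w hw, rot_rot, map_neg] at h1
  have h2 := hh w hw
  rw [covDiv_eq N Q _ hw, smul_eq_zero_iff_right (inv_ne_zero (volDensity_pos hw).ne')] at h2
  simp only [Fin.sum_univ_two, covDeriv, Target.proj, pd_pd_eq hQ hw] at h2
  -- The vectors w and Ω(w) are orthogonal of length |w|, so they compute |w|² times the Laplacian.
  have h3 : fderiv ℝ (fderiv ℝ Q) w w w + fderiv ℝ (fderiv ℝ Q) w (rot w) (rot w)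
      = (w 0 ^ 2 + w 1 ^ 2) • (fderiv ℝ (fderiv ℝ Q) w (EuclideanSpace.single 0 1)
          (EuclideanSpace.single 0 1) + fderiv ℝ (fderiv ℝ Q) w (EuclideanSpace.single 1 1)
          (EuclideanSpace.single 1 1)) := by
    generalize fderiv ℝ (fderiv ℝ Q) w = D
    rw [rot_eq_single_add_single]
    conv_lhs => rw [eq_single_add_single w]
    simp only [map_add, map_smul, add_apply, smul_apply]
    simp
    module
  generalize fderiv ℝ (fderiv ℝ Q) w (EuclideanSpace.single 0 1) (EuclideanSpace.single 0 1) = A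
    at h2 h3
  generalize fderiv ℝ (fderiv ℝ Q) w (EuclideanSpace.single 1 1) (EuclideanSpace.single 1 1) = B
    at h2 h3
  -- Harmonicity says that the flat Laplacian of `Q` is normal; `c` is its normal coefficient times
  -- |w|².
  refine ⟨(w 0 ^ 2 + w 1 ^ 2) * (N.curv * N.form A (Q w) + N.curv * N.form B (Q w)), ?_⟩
  linear_combination (norm := module) h3 - h1 + (w 0 ^ 2 + w 1 ^ 2) • h2

end

/-- On each ray the map is determined by its velocity at the origin. Equivariance sends the origin
to a pole and makes the differential there complex linear, so the rays fit together into w =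
(a+ib)z. -/
lemma eq_conformalMap_of_isHarmonic {Q : Plane → Fin 3 → ℝ} (hQ : IsSmoothMap Target.sphere Q)
    (he : IsEquivariant Q) (hh : IsHarmonic Target.sphere Q) :
    ∃ a b ε : ℝ, ε ^ 2 = 1 ∧ ∀ z ∈ disk, Q z = conformalMap a b ε z := by
  have h0 : (0 : Plane) ∈ disk := by simp [disk]
  have hn : ∀ z ∈ disk, Q z 0 ^ 2 + Q z 1 ^ 2 + Q z 2 ^ 2 = 1 := by
    intro z hz
    have := hQ.2 z hz
    simp only [Target.carrier, Target.form, Target.curv, Set.mem_ofPred_eq] at this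
    linarith
  have hrot0 : rot 0 = 0 := rotCLM.map_zero
  have hQ0 := he 0 h0
  rw [hrot0, map_zero] at hQ0
  have hq0 : Q 0 0 = 0 := by simpa [Target.rot] using (congrFun hQ0 1).symm
  have hq1 : Q 0 1 = 0 := by simpa [Target.rot] using (congrFun hQ0 0).symm
  have hε : Q 0 2 ^ 2 = 1 := by
    have := hn 0 h0
    rw [hq0, hq1] at this
    linarith
  have hd := he.deriv hQ h0 (EuclideanSpace.single 0 1)
  rw [hrot0, map_zero, zero_add] at hd
  have hr1 : rot (EuclideanSpace.single 0 1) = EuclideanSpace.single 1 1 := by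
    ext i
    fin_cases i <;> simp [rot]
  rw [hr1] at hd
  -- The multiplier a + ib is half the horizontal part of ∂₀Q at the origin, the half coming from
  -- the stereographic denominator 2.
  refine ⟨fderiv ℝ Q 0 (EuclideanSpace.single 0 1) 0 / 2,
    fderiv ℝ Q 0 (EuclideanSpace.single 0 1) 1 / 2, Q 0 2, hε, fun z hz => ?_⟩
  set U : Set ℝ := (fun t : ℝ => t • z) ⁻¹' disk with hU
  have hUo : IsOpen U := isOpen_disk.preimage (by fun_prop)
  have hIU : Set.Icc (0 : ℝ) 1 ⊆ U := by
    intro t ht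
    have hz' : ‖z‖ < 1 := by simpa [disk] using hz
    have : ‖t • z‖ < 1 := by
      rw [norm_smul, Real.norm_eq_abs, abs_of_nonneg ht.1]
      exact (mul_le_of_le_one_left (norm_nonneg z) ht.2).trans_lt hz'
    simpa [U, disk] using this
  have hD1 : ∀ t ∈ U, HasDerivAt (fun t : ℝ => Q (t • z)) (fderiv ℝ Q (t • z) z) t :=
    fun t ht => (hasFDerivAt_of_isSmoothMap hQ ht).comp_hasDerivAt t (hasDerivAt_smul_right t z)
  have hD2 : ∀ t ∈ U, HasDerivAt (fun t : ℝ => fderiv ℝ Q (t • z) z)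
      (fderiv ℝ (fderiv ℝ Q) (t • z) z z) t := fun t ht => hasDerivAt_fderiv_ray hQ ht
  -- The membership sits under the existential so that `choose` yields a function `c` on all of ℝ;
  -- its value off `U` is irrelevant.
  have hode : ∀ t : ℝ, ∃ c : ℝ, t ∈ U → t ^ 2 • fderiv ℝ (fderiv ℝ Q) (t • z) z z
      + t • fderiv ℝ Q (t • z) z = c • Q (t • z) - Target.rot (Target.rot (Q (t • z))) := by
    intro t
    by_cases ht : t ∈ U
    · obtain ⟨c, hc⟩ := radial_equation hQ he hh ht
      refine ⟨c, fun _ => ?_⟩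
      rw [← hc]
      simp [smul_smul, pow_two]
    · exact ⟨0, fun h => absurd h ht⟩
  choose c hc using hode
  have hsol := ray_solution hUo hIU (q := fun i t => Q (t • z) i)
    (p := fun i t => fderiv ℝ Q (t • z) z i)
    (d := fun i t => fderiv ℝ (fderiv ℝ Q) (t • z) z z i) (c := c) (ε := Q 0 2)
    (fun i t ht => hasDerivAt_pi.1 (hD1 t ht) i) (fun i t ht => hasDerivAt_pi.1 (hD2 t ht) i)
    (fun t ht => hn _ ht)
    (fun t ht => by simpa [Target.rot] using congrFun (hc t ht) 0)
    (fun t ht => by simpa [Target.rot] using congrFun (hc t ht) 1)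
    (fun t ht => by simpa [Target.rot] using congrFun (hc t ht) 2)
    (by simpa using hq0) (by simpa using hq1) (by simp)
  simp only [one_smul, zero_smul] at hsol
  have hdz : fderiv ℝ Q 0 z = z 0 • fderiv ℝ Q 0 (EuclideanSpace.single 0 1)
      + z 1 • Target.rot (fderiv ℝ Q 0 (EuclideanSpace.single 0 1)) := by
    rw [← hd]
    conv_lhs => rw [eq_single_add_single z]
    simp only [map_add, map_smul]
  set A := fderiv ℝ Q 0 (EuclideanSpace.single 0 1)
  have hp0 : fderiv ℝ Q 0 z 0 / 2 = mulRe (A 0 / 2) (A 1 / 2) z := by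
    rw [hdz]
    simp [Target.rot, mulRe]
    ring
  have hp1 : fderiv ℝ Q 0 z 1 / 2 = mulIm (A 0 / 2) (A 1 / 2) z := by
    rw [hdz]
    simp [Target.rot, mulIm]
    ring
  rw [hp0, hp1] at hsol
  obtain ⟨s0, s1, s2⟩ := hsol
  have hR : 1 + Q 0 2 * Q z 2 = 2 * stereoFactor (A 0 / 2) (A 1 / 2) z := by
    rw [stereoFactor]
    field_simp
    linarith
  ext i
  fin_cases i
  · simp only [conformalMap, Fin.zero_eta, Matrix.cons_val, s0, hR]
    ring
  · simp only [conformalMap, Fin.mk_one, Matrix.cons_val, s1, hR]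
    ring
  · simp only [conformalMap, Fin.reduceFinMk, Matrix.cons_val]
    linear_combination Q 0 2 * hR - Q z 2 * hε

/-! ### The explicit maps -/

lemma tanh_radius_div_two {z : Plane} (hz : z ∈ disk) : Real.tanh (radius z / 2) = ‖z‖ := by
  have hz' : ‖z‖ < 1 := by simpa [disk] using hz
  rw [radius, mul_div_cancel_left₀ _ two_ne_zero,
    Real.tanh_artanh ⟨by linarith [norm_nonneg z], hz'⟩]

/-- At the origin both sides vanish since division by zero gives 0, so the polar formulas need no
separate case there. -/
lemma norm_mul_coord_div (z : Plane) (i : Fin 2) : ‖z‖ * (z i / ‖z‖) = z i := by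
  by_cases h : z = 0
  · simp [h]
  · exact mul_div_cancel₀ _ (norm_ne_zero_iff.2 h)

lemma sin_two_mul_arctan (x : ℝ) : Real.sin (2 * Real.arctan x) = 2 * x / (1 + x ^ 2) := by
  have h : 0 < 1 + x ^ 2 := by positivity
  rw [Real.sin_two_mul, Real.sin_arctan, Real.cos_arctan, mul_assoc, div_mul_div_comm,
    Real.mul_self_sqrt h.le]
  ring

lemma cos_two_mul_arctan (x : ℝ) : Real.cos (2 * Real.arctan x) = 2 / (1 + x ^ 2) - 1 := by
  rw [Real.cos_two_mul, Real.cos_sq_arctan]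
  ring

lemma sinh_two_mul_artanh {x : ℝ} (hx : x ∈ Set.Ioo (-1) 1) :
    Real.sinh (2 * Real.artanh x) = 2 * x / (1 - x ^ 2) := by
  have h : 0 < 1 - x ^ 2 := by nlinarith [hx.1, hx.2]
  rw [Real.sinh_two_mul, Real.sinh_artanh hx, Real.cosh_artanh hx, mul_assoc, div_mul_div_comm,
    Real.mul_self_sqrt h.le]
  ring

lemma cosh_two_mul_artanh {x : ℝ} (hx : x ∈ Set.Ioo (-1) 1) :
    Real.cosh (2 * Real.artanh x) = (1 + x ^ 2) / (1 - x ^ 2) := by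
  have h : 0 < 1 - x ^ 2 := by nlinarith [hx.1, hx.2]
  rw [Real.cosh_two_mul, Real.sinh_artanh hx, Real.cosh_artanh hx, div_pow, div_pow,
    Real.sq_sqrt h.le]
  field_simp

/-- Since tanh(r/2) = |z|, the half polar angle has tangent λ|z|, so the stereographic coordinate is
λz. -/
lemma sphereMap_eq_conformalMap (lam : ℝ) {z : Plane} (hz : z ∈ disk) :
    sphereMap lam z = conformalMap lam 0 1 z := by
  have hs := norm_sq_eq z
  have hR : stereoFactor lam 0 z = (1 + (lam * ‖z‖) ^ 2)⁻¹ := by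
    rw [stereoFactor, mul_pow, hs]
    simp only [mulRe, mulIm]
    ring
  have h0 := norm_mul_coord_div z 0
  have h1 := norm_mul_coord_div z 1
  simp only [sphereMap, conformalMap, tanh_radius_div_two hz, sin_two_mul_arctan,
    cos_two_mul_arctan, hR, mulRe, mulIm]
  ext i
  fin_cases i
  · simp only [Fin.zero_eta, Matrix.cons_val]
    linear_combination 2 * lam * (1 + (lam * ‖z‖) ^ 2)⁻¹ * h0
  · simp only [Fin.mk_one, Matrix.cons_val]
    linear_combination 2 * lam * (1 + (lam * ‖z‖) ^ 2)⁻¹ * h1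
  · simp only [Fin.reduceFinMk, Matrix.cons_val]
    ring

/-- Double-argument formulas turn the map into rational functions of the coordinates in which only
|z|² enters, hence smooth at the origin; λ < 1 keeps the denominator positive. -/
lemma isSmoothMap_hyperbolicMap {lam : ℝ} (h0 : 0 ≤ lam) (h1 : lam < 1) :
    IsSmoothMap Target.hyperbolic (hyperbolicMap lam) := by
  have hpos : ∀ z ∈ disk, 0 < 1 - (lam * ‖z‖) ^ 2 ∧ lam * ‖z‖ ∈ Set.Ioo (-1 : ℝ) 1 := by
    intro z hz
    have hz' : ‖z‖ < 1 := by simpa [disk] using hz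
    have h2 : 0 ≤ lam * ‖z‖ := by positivity
    have h3 : lam * ‖z‖ < 1 := by nlinarith [norm_nonneg z]
    exact ⟨by nlinarith, by linarith, h3⟩
  have heq : ∀ z ∈ disk, hyperbolicMap lam z = ![2 * lam * z 0 / (1 - (lam * ‖z‖) ^ 2),
      2 * lam * z 1 / (1 - (lam * ‖z‖) ^ 2), (1 + (lam * ‖z‖) ^ 2) / (1 - (lam * ‖z‖) ^ 2)] := by
    intro z hz
    obtain ⟨-, hx⟩ := hpos z hz
    have h0 := norm_mul_coord_div z 0
    have h1 := norm_mul_coord_div z 1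
    simp only [hyperbolicMap, tanh_radius_div_two hz, sinh_two_mul_artanh hx,
      cosh_two_mul_artanh hx]
    ext i
    fin_cases i
    · simp only [Fin.zero_eta, Matrix.cons_val]
      linear_combination 2 * lam * (1 - (lam * ‖z‖) ^ 2)⁻¹ * h0
    · simp only [Fin.mk_one, Matrix.cons_val]
      linear_combination 2 * lam * (1 - (lam * ‖z‖) ^ 2)⁻¹ * h1
    · rfl
  refine ⟨ContDiffOn.congr ?_ heq, fun z hz => ?_⟩
  · rw [contDiffOn_pi]
    have hden : ContDiffOn ℝ ∞ (fun z : Plane => 1 - (lam * ‖z‖) ^ 2) disk := by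
      have : (fun z : Plane => 1 - (lam * ‖z‖) ^ 2)
          = fun z : Plane => 1 - lam ^ 2 * (z 0 ^ 2 + z 1 ^ 2) := by
        ext z
        rw [mul_pow, norm_sq_eq]
      rw [this]
      fun_prop
    have hnum : ContDiffOn ℝ ∞ (fun z : Plane => 1 + (lam * ‖z‖) ^ 2) disk := by
      have : (fun z : Plane => 1 + (lam * ‖z‖) ^ 2)
          = fun z : Plane => 2 - (1 - (lam * ‖z‖) ^ 2) := by
        ext z
        ring
      rw [this]
      exact contDiffOn_const.sub hden
    intro i
    fin_cases i
    · exact ContDiffOn.div (f := fun z : Plane => 2 * lam * z 0) (by fun_prop) hden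
        fun z hz => (hpos z hz).1.ne'
    · exact ContDiffOn.div (f := fun z : Plane => 2 * lam * z 1) (by fun_prop) hden
        fun z hz => (hpos z hz).1.ne'
    · exact hnum.div hden fun z hz => (hpos z hz).1.ne'
  · obtain ⟨hd, -⟩ := hpos z hz
    have hs := norm_sq_eq z
    rw [heq z hz]
    simp only [Target.carrier, Target.form, Target.curv, Set.mem_ofPred_eq, Matrix.cons_val]
    refine ⟨?_, by positivity⟩
    have hy : (lam * ‖z‖) ^ 2 = lam ^ 2 * (z 0 ^ 2 + z 1 ^ 2) := by rw [mul_pow, hs]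
    have hd' := hd.ne'
    generalize (lam * ‖z‖) ^ 2 = y at *
    field_simp
    linear_combination -4 * hy

end HypHarmonic

end

theorem mainTheorem4 :
    (∀ (N : HypHarmonic.Target) (Q : HypHarmonic.Plane → Fin 3 → ℝ),
      HypHarmonic.IsSmoothMap N Q → HypHarmonic.HasFiniteEnergy N Q →
      HypHarmonic.IsEquivariant Q → HypHarmonic.IsHarmonic N Q →
      HypHarmonic.WeaklyLinearlyStable N Q) ∧
    (∀ lam : ℝ, 0 ≤ lam →
      HypHarmonic.WeaklyLinearlyStable HypHarmonic.Target.sphere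
        (HypHarmonic.sphereMap lam)) ∧
    (∀ lam : ℝ, 0 ≤ lam → lam < 1 →
      HypHarmonic.WeaklyLinearlyStable HypHarmonic.Target.hyperbolic
        (HypHarmonic.hyperbolicMap lam)) := by
  refine ⟨fun N Q hQ _ he hh => ?_, fun lam _ => ?_, fun lam h0 h1 => ?_⟩
  · cases N
    · obtain ⟨a, b, ε, hε, h⟩ := HypHarmonic.eq_conformalMap_of_isHarmonic hQ he hh
      exact HypHarmonic.weaklyLinearlyStable_of_eq_conformalMap hε h
    · exact HypHarmonic.weaklyLinearlyStable_hyperbolic hQ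
  · exact HypHarmonic.weaklyLinearlyStable_of_eq_conformalMap (a := lam) (b := 0) (ε := 1)
      (by norm_num) fun z hz => HypHarmonic.sphereMap_eq_conformalMap lam hz
  · exact HypHarmonic.weaklyLinearlyStable_hyperbolic
      (HypHarmonic.isSmoothMap_hyperbolicMap h0 h1)
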